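/- Let $H$ be a real or complex Hilbert space. A countable family $(f_i)$ in $H$ is a frame for a closed subspace $V\subset H$ containing it if there are $A,B>0$ with $A\|x\|^2\le\sum_i|\langle x,f_i\rangle|^2\le B\|x\|^2$ for all $x\in V$. A frame for $H$ has the *subframe property* if every subfamily is a frame for its closed linear span; it is a *Riesz frame* if, moreover, the bounds $A,B$ can be chosen to be the same for all subfamilies. A family $(g_i)_{i\in I}$ is a *Riesz basis* for $H$ if its closed linear span is $H$ and there are $c,C>0$ with $c\,(\sum|a_i|^2)^{1/2}\le\|\sum a_ig_i\|\le C\,(\sum|a_i|^2)^{1/2}$ for all finitely supported scalar families $(a_i)$. A vector has *infinite support* with respect to $(g_i)$ if infinitely many coefficients of its expansion $\sum a_ig_i$ are nonzero. **Theorem 3.2.** Let $(f_i)_{i=1}^\infty$ be a frame for $H$. The following are equivalent: (1) $(f_i)$ has the subframe property. (2) $(f_i)$ can be divided (by a partition of the index set) into three families $(g_i)_{i\in I}$, $(h_i)_{i\in\Gamma}$ and $(k_i)_{i\in\Lambda}$ with $\Lambda$ finite (each of the three may be empty), such that $(g_i)_{i\in I}$ is a Riesz basis for $H$, and there are a finite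 set $F\subset I$, with $G=\operatorname{span}(g_i)_{i\in F}$, and decompositions $h_i=h_i^1+h_i^2$ $(i\in\Gamma)$ with $h_i^2\in G$ and $h_i^1\in\overline{\operatorname{span}}(g_j)_{j\in I\setminus F}$, satisfying: (i) every $k_i$ has infinite support with respect to $(g_j)_{j\in I}$; (ii) $\sum_{i\in\Gamma}\|h_i^2\|^2<\infty$; (iii) $((g_i)_{i\in I},(h_i^1)_{i\in\Gamma})$ is a Riesz frame for $H$. (3) There is a bounded invertible linear operator $T:H\to H$ with bounded inverse such that the equivalent frame $(Tf_i)$ can be divided as in (2), with the condition $h_i^1\in\overline{\operatorname{span}}(g_j)_{j\in I\setminus F}$ replaced by $h_i^1\in G^\perp$. In particular (taking $T$ to be the identity), a frame that can itself be divided in the way described in (3) has the subframe property. -/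

import Mathlib

namespace FrameTheory

section

variable {𝕜 : Type*} [RCLike 𝕜] {H : Type*} [NormedAddCommGroup H] [InnerProductSpace 𝕜 H]
variable {ι : Type*}

variable (𝕜) in
/-- The closed linear span of a family of vectors. -/
def closedSpan (f : ι → H) : Submodule 𝕜 H :=
  (Submodule.span 𝕜 (Set.range f)).topologicalClosure

/-- `A ‖x‖² ≤ ∑ |⟨x, f i⟩|² ≤ B ‖x‖²` (with a convergent sum) for every `x` in the subspace `V`. -/
def HasFrameBounds (A B : ℝ) (f : ι → H) (V : Submodule 𝕜 H) : Prop :=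
  ∀ x ∈ V, Summable (fun i => ‖inner 𝕜 x (f i)‖ ^ 2) ∧
    A * ‖x‖ ^ 2 ≤ ∑' i, ‖inner 𝕜 x (f i)‖ ^ 2 ∧
    ∑' i, ‖inner 𝕜 x (f i)‖ ^ 2 ≤ B * ‖x‖ ^ 2

variable (𝕜) in
/-- `f` is a frame for the whole space `H`. -/
def IsFrame (f : ι → H) : Prop :=
  ∃ A B : ℝ, 0 < A ∧ 0 < B ∧ HasFrameBounds A B f (⊤ : Submodule 𝕜 H)

variable (𝕜) in
/-- `f` is a frame for its closed linear span. -/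
def IsFrameSequence (f : ι → H) : Prop :=
  ∃ A B : ℝ, 0 < A ∧ 0 < B ∧ HasFrameBounds A B f (closedSpan 𝕜 f)

variable (𝕜) in
/-- Every subfamily of `f` is a frame for its closed linear span. -/
def HasSubframeProperty (f : ι → H) : Prop :=
  ∀ s : Set ι, IsFrameSequence 𝕜 (fun i : s => f i)

variable (𝕜) in
/-- `f` is a frame for `H`, and all its subfamilies are frames for their closed linear spans with
common frame bounds. -/
def IsRieszFrame (f : ι → H) : Prop :=
  IsFrame 𝕜 f ∧ ∃ A B : ℝ, 0 < A ∧ 0 < B ∧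
    ∀ s : Set ι, HasFrameBounds A B (fun i : s => f i) (closedSpan 𝕜 (fun i : s => f i))

variable (𝕜) in
/-- `g` is total in `H` and `c (∑ |a i|²)^(1/2) ≤ ‖∑ a i g i‖ ≤ C (∑ |a i|²)^(1/2)` for all finite
sequences of scalars (and hence, by density, for all square-summable ones). -/
def IsRieszBasis (g : ι → H) : Prop :=
  closedSpan 𝕜 g = ⊤ ∧ ∃ c C : ℝ, 0 < c ∧ 0 < C ∧ ∀ (s : Finset ι) (a : ι → 𝕜),
    c * √(∑ i ∈ s, ‖a i‖ ^ 2) ≤ ‖∑ i ∈ s, a i • g i‖ ∧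
    ‖∑ i ∈ s, a i • g i‖ ≤ C * √(∑ i ∈ s, ‖a i‖ ^ 2)

variable (𝕜) in
/-- `x` has an expansion `x = ∑ a j g j` with infinitely many nonzero coefficients; for a Riesz
basis `g` the coefficients are unique, and their support is the support of `x`. -/
def HasInfiniteSupport (g : ι → H) (x : H) : Prop :=
  ∃ a : ι → 𝕜, HasSum (fun j => a j • g j) x ∧ (Function.support a).Infinite

variable (𝕜) in
/-- The family `f` is divided into `(g i) = (f i)_{i ∈ I}`, `(h i) = (f i)_{i ∈ Γ}` and
`(k i) = (f i)_{i ∈ Λ}`, and `h i = h₁ i + h₂ i`, where `h₂ i` lies in the span `G` of the finitely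
many `g i` with `i ∈ F`. The position of the `h₁ i` relative to `G` is not part of this
structure. -/
structure IsSplitting (f : ι → H) (I Γ Λ : Set ι) (F : Finset ι) (h₁ h₂ : ι → H) : Prop where
  cover : I ∪ Γ ∪ Λ = Set.univ
  disjoint_I_Γ : Disjoint I Γ
  disjoint_I_Λ : Disjoint I Λ
  disjoint_Γ_Λ : Disjoint Γ Λ
  finite_Λ : Λ.Finite
  F_subset : (F : Set ι) ⊆ I
  rieszBasis : IsRieszBasis 𝕜 (fun i : I => f i)
  infiniteSupport : ∀ i ∈ Λ, HasInfiniteSupport 𝕜 (fun j : I => f j) (f i)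
  eq_add : ∀ i ∈ Γ, f i = h₁ i + h₂ i
  mem_G : ∀ i ∈ Γ, h₂ i ∈ Submodule.span 𝕜 (f '' (F : Set ι))
  summable : Summable (fun i : Γ => ‖h₂ i‖ ^ 2)
  rieszFrame : IsRieszFrame 𝕜 (Sum.elim (fun i : I => f i) (fun i : Γ => h₁ i))

variable (𝕜) in
/-- A splitting in which the `h₁ i` lie in the natural complement of `G` determined by the Riesz
basis, the closed linear span of the `g i` with `i ∉ F`. If `(g i)` is orthonormal, this is `Gᗮ`. -/
def SplitsNaturally (f : ι → H) : Prop :=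
  ∃ (I Γ Λ : Set ι) (F : Finset ι) (h₁ h₂ : ι → H), IsSplitting 𝕜 f I Γ Λ F h₁ h₂ ∧
    ∀ i ∈ Γ, h₁ i ∈ closedSpan 𝕜 (fun j : (I \ (F : Set ι) : Set ι) => f j)

variable (𝕜) in
/-- A splitting in which the `h₁ i` lie in the orthogonal complement of `G`. -/
def SplitsOrthogonally (f : ι → H) : Prop :=
  ∃ (I Γ Λ : Set ι) (F : Finset ι) (h₁ h₂ : ι → H), IsSplitting 𝕜 f I Γ Λ F h₁ h₂ ∧
    ∀ i ∈ Γ, h₁ i ∈ (Submodule.span 𝕜 (f '' (F : Set ι)))ᗮ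

end

end FrameTheory

/-!
A Bessel family is a frame for its closed span exactly when its analysis operator
`x ↦ (⟨f i, x⟩)ᵢ`, with values in ℓ², has closed range (`isFrameSequence_iff_isClosed_range`), and
closedness of the range of an operator between Banach spaces is stable under perturbations of finite
rank.

*Splittings have the subframe property* (`IsSplitting.hasSubframeProperty`). A subfamily of `f`
differs from a subfamily of the Riesz frame `((g i), (h₁ i))`, extended by zeros over `Λ`, by
vectors `h₂ i` and `k i` in a fixed finite-dimensional space, with square-summable norms. The two
analysis operators therefore differ by a bounded operator of finite rank. Neither the position of
the `h₁ i` nor the infinite supports of the `k i` matter here, so this covers both kinds of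
splitting.

*The subframe property gives a natural splitting* (`HasSubframeProperty.splitsNaturally`). Lower
frame bounds are used in the dual form `HasStableExpansions`: each vector of the span is a finite
linear combination of the family with ℓ²-controlled coefficients. A gliding hump argument
(`HasSubframeProperty.exists_uniform`) produces a finite set `E`, an `N` and one constant that
serves all families indexed by `E ∪ t` with `t ⊆ [N, ∞)`: otherwise a union of finite sets chosen
inductively would index a subfamily with no lower frame bound. Replacing `E` by a linearly
independent subset, completing it from `[N, ∞)`, and adjoining those of the remaining finitely many
vectors that lie outside the closed span reached so far, one obtains a linearly independent
subfamily with dense span which still has stable expansions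
(`HasSubframeProperty.exists_linearIndepOn`); this is the Riesz basis `(g i)`. The `k i` are the
vectors with `i < N` outside the algebraic span of the basis, `F` is taken large enough for the
other vectors with `i < N` to lie in `G`, and `h₂ i = p (h i)`, where `p` is the projection onto `G`
along the closed span of the other basis vectors. Square-summability of the `h₂ i` holds because `p`
has finite rank and `f` is Bessel, and the Riesz frame property is
`exists_hasStableExpansions_of_projection`.

*A natural splitting becomes orthogonal after an isomorphism*
(`SplitsNaturally.exists_splitsOrthogonally`), one that fixes `G` and carries its natural complement
onto `Gᗮ`. The subframe property is invariant under isomorphisms (`HasSubframeProperty.map`).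
-/

namespace FrameTheory

variable {𝕜 : Type*} [RCLike 𝕜] {H : Type*} [NormedAddCommGroup H] [InnerProductSpace 𝕜 H]
variable {ι κ : Type*}

/-! ### Closed spans, Bessel families and reindexing -/

variable (𝕜) in
lemma isClosed_closedSpan (f : ι → H) : IsClosed (closedSpan 𝕜 f : Set H) :=
  Submodule.isClosed_topologicalClosure _

instance [CompleteSpace H] (f : ι → H) : CompleteSpace (closedSpan 𝕜 f) :=
  (isClosed_closedSpan 𝕜 f).completeSpace_coe

variable (𝕜) in
lemma mem_closedSpan (f : ι → H) (i : ι) : f i ∈ closedSpan 𝕜 f :=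
  Submodule.le_topologicalClosure _ (Submodule.subset_span ⟨i, rfl⟩)

lemma closedSpan_le {f : ι → H} {V : Submodule 𝕜 H} (hV : IsClosed (V : Set H))
    (h : ∀ i, f i ∈ V) : closedSpan 𝕜 f ≤ V :=
  Submodule.topologicalClosure_minimal _
    (Submodule.span_le.2 (by rintro _ ⟨i, rfl⟩; exact h i)) hV

lemma closedSpan_comp {φ : κ → ι} {w : ι → H} (h0 : ∀ i ∉ Set.range φ, w i = 0) :
    closedSpan 𝕜 (fun k => w (φ k)) = closedSpan 𝕜 w := by
  refine le_antisymm (closedSpan_le (isClosed_closedSpan 𝕜 w) fun k => mem_closedSpan 𝕜 w _)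
    (closedSpan_le (isClosed_closedSpan 𝕜 _) fun i => ?_)
  by_cases hi : i ∈ Set.range φ
  · obtain ⟨k, rfl⟩ := hi
    exact mem_closedSpan 𝕜 (fun k => w (φ k)) k
  · rw [h0 i hi]
    exact zero_mem _

lemma hasFrameBounds_comp {φ : κ → ι} (hφ : Function.Injective φ) {w : ι → H}
    (h0 : ∀ i ∉ Set.range φ, w i = 0) {A B : ℝ} {V : Submodule 𝕜 H} :
    HasFrameBounds A B (fun k => w (φ k)) V ↔ HasFrameBounds A B w V := by
  have h1 : ∀ x : H, ∀ i ∉ Set.range φ, ‖inner 𝕜 x (w i)‖ ^ 2 = 0 := fun x i hi => by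
    simp [h0 i hi]
  have h2 : ∀ x : H, Function.support (fun i => ‖inner 𝕜 x (w i)‖ ^ 2) ⊆ Set.range φ :=
    fun x i hi => by
      by_contra h
      exact hi (h1 x i h)
  unfold HasFrameBounds
  refine forall₂_congr fun x _ => ?_
  rw [← hφ.summable_iff (h1 x), ← hφ.tsum_eq (h2 x)]
  rfl

variable (𝕜) in
/-- The upper frame inequality, for all vectors of `H` and not only for those in the closed span of
the family. -/
def IsBessel (B : ℝ) (f : ι → H) : Prop :=
  ∀ x : H, Summable (fun i => ‖inner 𝕜 x (f i)‖ ^ 2) ∧ ∑' i, ‖inner 𝕜 x (f i)‖ ^ 2 ≤ B * ‖x‖ ^ 2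

lemma HasFrameBounds.isBessel [CompleteSpace H] {A B : ℝ} (hB : 0 ≤ B) {f : ι → H}
    (h : HasFrameBounds A B f (closedSpan 𝕜 f)) : IsBessel 𝕜 B f := by
  intro x
  have hP : ∀ i, inner 𝕜 x (f i) = inner 𝕜 ((closedSpan 𝕜 f).starProjection x) (f i) := fun i => by
    rw [Submodule.inner_starProjection_left_eq_right,
      Submodule.starProjection_eq_self_iff.2 (mem_closedSpan 𝕜 f i)]
  obtain ⟨h1, -, h2⟩ := h _ (Submodule.starProjection_apply_mem (closedSpan 𝕜 f) x)
  simp only [hP]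
  refine ⟨h1, h2.trans ?_⟩
  gcongr
  exact Submodule.norm_starProjection_apply_le _ x

lemma IsBessel.comp {B : ℝ} {f : ι → H} (h : IsBessel 𝕜 B f) {φ : κ → ι}
    (hφ : Function.Injective φ) : IsBessel 𝕜 B (fun k => f (φ k)) := fun x => by
  have hs := (h x).1.comp_injective hφ
  exact ⟨hs, (hs.tsum_le_tsum_of_inj (g := fun i => ‖inner 𝕜 x (f i)‖ ^ 2) φ hφ
    (fun _ _ => by positivity) (fun _ => le_rfl) (h x).1).trans (h x).2⟩

lemma IsBessel.sum_le {B : ℝ} {f : ι → H} (h : IsBessel 𝕜 B f) (x : H) (s : Finset ι) :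
    ∑ i ∈ s, ‖inner 𝕜 x (f i)‖ ^ 2 ≤ B * ‖x‖ ^ 2 :=
  ((h x).1.sum_le_tsum s fun _ _ => by positivity).trans (h x).2

/-- The Cauchy–Schwarz inequality applied to `‖x‖² = ∑ a i ⟨x, f i⟩`. It turns bounds for the
coefficients `a` into lower frame inequalities, and upper frame inequalities into bounds for `x`. -/
lemma sq_norm_sum_smul_le (x : H) (f : ι → H) (s : Finset ι) (a : ι → 𝕜)
    (hx : x = ∑ i ∈ s, a i • f i) :
    ‖x‖ ^ 4 ≤ (∑ i ∈ s, ‖a i‖ ^ 2) * ∑ i ∈ s, ‖inner 𝕜 x (f i)‖ ^ 2 := by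
  have h1 : ‖x‖ ^ 2 ≤ ∑ i ∈ s, ‖a i‖ * ‖inner 𝕜 x (f i)‖ := by
    have : (‖x‖ : 𝕜) ^ 2 = ∑ i ∈ s, a i * inner 𝕜 x (f i) := by
      rw [← inner_self_eq_norm_sq_to_K]
      conv_lhs => rw [hx, inner_sum, ← hx]
      simp [inner_smul_right]
    calc ‖x‖ ^ 2 = ‖(‖x‖ : 𝕜) ^ 2‖ := by simp
      _ ≤ _ := by
        rw [this]
        exact (norm_sum_le _ _).trans (by simp)
  calc ‖x‖ ^ 4 = (‖x‖ ^ 2) ^ 2 := by ring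
    _ ≤ (∑ i ∈ s, ‖a i‖ * ‖inner 𝕜 x (f i)‖) ^ 2 := by gcongr
    _ ≤ _ := Finset.sum_mul_sq_le_sq_mul_sq _ _ _

lemma IsBessel.sq_norm_sum_le {B : ℝ} (hB : 0 ≤ B) {f : ι → H} (h : IsBessel 𝕜 B f)
    (s : Finset ι) (a : ι → 𝕜) : ‖∑ i ∈ s, a i • f i‖ ^ 2 ≤ B * ∑ i ∈ s, ‖a i‖ ^ 2 := by
  set x := ∑ i ∈ s, a i • f i with hx
  have h1 : ‖x‖ ^ 4 ≤ (∑ i ∈ s, ‖a i‖ ^ 2) * (B * ‖x‖ ^ 2) :=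
    (sq_norm_sum_smul_le x f s a hx).trans (by gcongr; exact h.sum_le x s)
  rcases eq_or_lt_of_le (sq_nonneg ‖x‖) with h0 | h0
  · rw [← h0]
    positivity
  · exact le_of_mul_le_mul_right (by nlinarith) h0

/-! ### The analysis operator -/

/-- The analysis operator of a Bessel family, `x ↦ (⟨f i, x⟩)ᵢ`. -/
lemma IsBessel.exists_analysis {B : ℝ} {f : ι → H} (h : IsBessel 𝕜 B f) :
    ∃ Θ : H →L[𝕜] lp (fun _ : ι => 𝕜) 2, ∀ x i, Θ x i = inner 𝕜 (f i) x := by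
  have hmem : ∀ x : H, Memℓp (fun i => inner 𝕜 (f i) x) 2 := fun x => by
    refine memℓp_gen ?_
    have := (h x).1
    simpa [norm_inner_symm] using this
  let L : H →ₗ[𝕜] lp (fun _ : ι => 𝕜) 2 :=
    { toFun := fun x => ⟨fun i => inner 𝕜 (f i) x, hmem x⟩
      map_add' := fun x y => by
        ext i
        simp only [inner_add_right]
        rfl
      map_smul' := fun c x => by
        ext i
        simp [inner_smul_right] }
  refine ⟨L.mkContinuous (√B) fun x => ?_, fun x i => rfl⟩
  refine lp.norm_le_of_forall_sum_le (by norm_num) (by positivity) fun s => ?_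
  have h1 := h.sum_le x s
  have h2 : B * ‖x‖ ^ 2 ≤ (√B * ‖x‖) ^ 2 := by
    rw [mul_pow]
    gcongr
    rcases le_or_gt 0 B with hB | hB
    · rw [Real.sq_sqrt hB]
    · exact hB.le.trans (by positivity)
  have h3 := h1.trans h2
  simpa [L, norm_inner_symm] using h3

lemma hasSum_sq_norm_analysis {f : ι → H} {Θ : H →L[𝕜] lp (fun _ : ι => 𝕜) 2}
    (hΘ : ∀ x i, Θ x i = inner 𝕜 (f i) x) (x : H) :
    HasSum (fun i => ‖inner 𝕜 x (f i)‖ ^ 2) (‖Θ x‖ ^ 2) := by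
  have := lp.hasSum_norm (p := 2) (by norm_num) (Θ x)
  simpa [hΘ, norm_inner_symm] using this

lemma isBessel_of_analysis {f : ι → H} {Θ : H →L[𝕜] lp (fun _ : ι => 𝕜) 2}
    (hΘ : ∀ x i, Θ x i = inner 𝕜 (f i) x) : IsBessel 𝕜 (‖Θ‖ ^ 2) f := fun x =>
  ⟨(hasSum_sq_norm_analysis hΘ x).summable, by
    rw [(hasSum_sq_norm_analysis hΘ x).tsum_eq, ← mul_pow]
    gcongr
    exact Θ.le_opNorm x⟩

/-- A Bessel family is a frame for its closed linear span if and only if its analysis operator has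
closed range: the kernel of the analysis operator is the orthogonal complement of this span. -/
lemma isFrameSequence_iff_isClosed_range [CompleteSpace H] {f : ι → H}
    {Θ : H →L[𝕜] lp (fun _ : ι => 𝕜) 2} (hΘ : ∀ x i, Θ x i = inner 𝕜 (f i) x) :
    IsFrameSequence 𝕜 f ↔ IsClosed (Θ.range : Set (lp (fun _ : ι => 𝕜) 2)) := by
  set V := closedSpan 𝕜 f with hV
  set Ψ : V →L[𝕜] lp (fun _ : ι => 𝕜) 2 := Θ ∘L V.subtypeL with hΨ
  have hP : ∀ x, Θ x = Ψ (V.orthogonalProjectionOnto x) := fun x => by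
    ext i
    change Θ x i = Θ (V.orthogonalProjectionOnto x) i
    rw [hΘ, hΘ]
    exact (Submodule.inner_orthogonalProjectionOnto_eq_of_mem_left
      (⟨f i, mem_closedSpan 𝕜 f i⟩ : V) x).symm
  have hrange : (Θ.range : Set (lp (fun _ : ι => 𝕜) 2)) = Set.range Ψ := by
    ext y
    constructor
    · rintro ⟨x, rfl⟩
      exact ⟨_, (hP x).symm⟩
    · rintro ⟨x, rfl⟩
      exact ⟨x, rfl⟩
  have hinj : Function.Injective Ψ := by
    refine (injective_iff_map_eq_zero Ψ).2 fun x hx => ?_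
    have h1 : closedSpan 𝕜 f ≤ (𝕜 ∙ (x : H))ᗮ := by
      refine closedSpan_le (Submodule.isClosed_orthogonal _) fun i => ?_
      rw [Submodule.mem_orthogonal_singleton_iff_inner_left, ← hΘ]
      exact congrArg (fun y : lp (fun _ : ι => 𝕜) 2 => y i) hx
    have h2 := (Submodule.mem_orthogonal_singleton_iff_inner_left).1 (h1 x.2)
    exact Subtype.ext (inner_self_eq_zero.1 h2)
  rw [hrange, Ψ.isClosed_range_iff_antilipschitz_of_injective hinj]
  constructor
  · rintro ⟨A, B, hA, hB, h⟩
    have key : ∀ x : V, ‖x‖ ≤ (√(1 / A)) * ‖Ψ x‖ := fun x => by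
      have h1 := (h x x.2).2.1
      rw [(hasSum_sq_norm_analysis hΘ (x : H)).tsum_eq] at h1
      refine le_of_sq_le_sq ?_ (by positivity)
      rw [mul_pow, Real.sq_sqrt (by positivity), one_div, inv_mul_eq_div, le_div_iff₀ hA, mul_comm]
      exact h1
    refine ⟨Real.toNNReal (√(1 / A)), Ψ.antilipschitz_of_bound fun x => ?_⟩
    rw [Real.coe_toNNReal _ (by positivity)]
    exact key x
  · rintro ⟨K, hK⟩
    refine ⟨1 / ((K : ℝ) ^ 2 + 1), ‖Θ‖ ^ 2 + 1, by positivity, by positivity, fun x hx => ?_⟩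
    obtain ⟨h1, h2⟩ := isBessel_of_analysis hΘ x
    refine ⟨h1, ?_, h2.trans (by gcongr; linarith)⟩
    rw [(hasSum_sq_norm_analysis hΘ x).tsum_eq]
    have h3 : ‖x‖ ≤ K * ‖Θ x‖ := by
      have := hK.le_mul_dist (⟨x, hx⟩ : V) 0
      simpa [hΨ, dist_zero_right] using this
    have h4 : ‖x‖ ^ 2 ≤ (K * ‖Θ x‖) ^ 2 := by gcongr
    rw [one_div, inv_mul_le_iff₀ (by positivity)]
    nlinarith [sq_nonneg ‖Θ x‖]

lemma IsFrameSequence.exists_isBessel [CompleteSpace H] {f : ι → H} (h : IsFrameSequence 𝕜 f) :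
    ∃ B, 0 < B ∧ IsBessel 𝕜 B f := by
  obtain ⟨A, B, hA, hB, h⟩ := h
  exact ⟨B, hB, h.isBessel hB.le⟩

/-! ### Finite-rank perturbations -/

lemma isStrictMap_of_isClosed_range {X Y : Type*} [NormedAddCommGroup X] [NormedSpace 𝕜 X]
    [CompleteSpace X] [NormedAddCommGroup Y] [NormedSpace 𝕜 Y] [CompleteSpace Y] (D : X →L[𝕜] Y)
    (h : IsClosed (D.range : Set Y)) : Topology.IsStrictMap D := by
  have : CompleteSpace D.range := h.completeSpace_coe
  exact (D.codRestrict D.range fun x => ⟨x, rfl⟩).isQuotientMap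
    (by rintro ⟨_, x, rfl⟩; exact ⟨x, rfl⟩)

/-- A summable perturbation inside a finite-dimensional space changes the analysis operator by an
operator of finite rank, and closedness of the range is stable under such perturbations. -/
lemma IsFrameSequence.add_of_finiteDimensional [CompleteSpace H] {u v : ι → H}
    (hu : IsFrameSequence 𝕜 u) (V : Submodule 𝕜 H) [FiniteDimensional 𝕜 V] (hv : ∀ i, v i ∈ V)
    (hs : Summable fun i => ‖v i‖ ^ 2) : IsFrameSequence 𝕜 (fun i => u i + v i) := by
  obtain ⟨B, -, hB⟩ := hu.exists_isBessel
  obtain ⟨Θ, hΘ⟩ := hB.exists_analysis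
  have hv' : IsBessel 𝕜 (∑' i, ‖v i‖ ^ 2) v := fun x => by
    have h1 : ∀ i, ‖inner 𝕜 x (v i)‖ ^ 2 ≤ ‖v i‖ ^ 2 * ‖x‖ ^ 2 := fun i => by
      rw [mul_comm, ← mul_pow]
      gcongr
      exact norm_inner_le_norm x (v i)
    have h2 := hs.mul_right (‖x‖ ^ 2)
    have h3 := h2.of_nonneg_of_le (fun i => by positivity) h1
    exact ⟨h3, (h3.tsum_le_tsum h1 h2).trans_eq tsum_mul_right⟩
  obtain ⟨Ξ, hΞ⟩ := hv'.exists_analysis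
  have hsum : ∀ x i, (Θ + Ξ) x i = inner 𝕜 (u i + v i) x := fun x i => by
    simp [hΘ, hΞ, inner_add_left]
  rw [isFrameSequence_iff_isClosed_range hsum]
  have hfin : Ξ.toLinearMap.HasFiniteRange := by
    have : Ξ.toLinearMap =
        (Ξ ∘L V.subtypeL).toLinearMap ∘ₗ V.orthogonalProjectionOnto.toLinearMap := by
      ext x i
      change Ξ x i = Ξ (V.orthogonalProjectionOnto x) i
      rw [hΞ, hΞ]
      exact (Submodule.inner_orthogonalProjectionOnto_eq_of_mem_left (⟨v i, hv i⟩ : V) x).symm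
    rw [this]
    exact LinearMap.HasFiniteRange.comp_left (u := V.orthogonalProjectionOnto.toLinearMap)
      .of_isNoetherian_rng _
  have hequiv : LinearMap.FiniteRangeSetoid.setoid.r Θ.toLinearMap (Θ + Ξ).toLinearMap := by
    refine LinearMap.FiniteRangeSetoid.equiv_iff_hasFiniteRange.2 ?_
    have : Θ.toLinearMap - (Θ + Ξ).toLinearMap = -Ξ.toLinearMap := by
      ext x
      simp
    rw [this]
    exact hfin.neg
  have hcl := (isFrameSequence_iff_isClosed_range hΘ).1 hu
  exact ((ContinuousLinearMap.isStrictMap_isClosed_range_iff_of_finiteRangeSetoid Θ (Θ + Ξ)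
    hequiv).1 ⟨isStrictMap_of_isClosed_range Θ hcl, hcl⟩).2

/-! ### Invariance under isomorphisms -/

lemma symm_mem_closedSpan (T : H ≃L[𝕜] H) {f : ι → H} {y : H}
    (hy : y ∈ closedSpan 𝕜 (fun i => T (f i))) : T.symm y ∈ closedSpan 𝕜 f := by
  have : closedSpan 𝕜 (fun i => T (f i)) ≤
      (closedSpan 𝕜 f).comap T.symm.toLinearEquiv.toLinearMap :=
    closedSpan_le ((isClosed_closedSpan 𝕜 f).preimage T.symm.continuous) fun i => by
      simpa using mem_closedSpan 𝕜 f i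
  exact this hy

lemma closedSpan_map_eq_top (T : H ≃L[𝕜] H) {f : ι → H} (h : closedSpan 𝕜 f = ⊤) :
    closedSpan 𝕜 (fun i => T (f i)) = ⊤ := by
  refine eq_top_iff.2 fun y _ => ?_
  have h1 : T.symm (T (T.symm y)) ∈ closedSpan 𝕜 (fun i => T.symm (T (f i))) := by
    simp [h]
  simpa using symm_mem_closedSpan T.symm h1

lemma HasFrameBounds.map [CompleteSpace H] {A B : ℝ} (hA : 0 ≤ A) (hB : 0 ≤ B) {f : ι → H}
    (h : HasFrameBounds A B f (closedSpan 𝕜 f)) (T : H ≃L[𝕜] H) :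
    HasFrameBounds (A / (‖(T.symm : H →L[𝕜] H)‖ + 1) ^ 2) (B * (‖(T : H →L[𝕜] H)‖ + 1) ^ 2)
      (fun i => T (f i)) (closedSpan 𝕜 (fun i => T (f i))) := by
  intro y hy
  set K := ‖(T.symm : H →L[𝕜] H)‖ + 1
  set V := closedSpan 𝕜 f
  have hK : 0 < K := by positivity
  have hv : T.symm y ∈ V := symm_mem_closedSpan T hy
  have hTv : (T : H →L[𝕜] H) (T.symm y) = y := by simp
  set v := T.symm y
  have hvK : ‖v‖ ≤ K * ‖y‖ :=
    ((T.symm : H →L[𝕜] H).le_opNorm y).trans (by gcongr; simp [K])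
  set z := (T : H →L[𝕜] H).adjoint y
  have hz : ‖z‖ ≤ (‖(T : H →L[𝕜] H)‖ + 1) * ‖y‖ := by
    refine ((T : H →L[𝕜] H).adjoint.le_opNorm y).trans ?_
    rw [LinearIsometryEquiv.norm_map]
    gcongr
    simp
  have e1 : ∀ i, inner 𝕜 y (T (f i)) = inner 𝕜 z (f i) := fun i => by
    rw [ContinuousLinearMap.adjoint_inner_left]
    rfl
  have e2 : ∀ w ∈ V, inner 𝕜 z w = inner 𝕜 (V.starProjection z) w := fun w hw => by
    rw [Submodule.inner_starProjection_left_eq_right, Submodule.starProjection_eq_self_iff.2 hw]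
  obtain ⟨h1, h2⟩ := h.isBessel hB z
  have h3 := (h _ (V.starProjection_apply_mem z)).2.1
  simp only [e1]
  refine ⟨h1, ?_, h2.trans ?_⟩
  · simp only [← e2 _ (mem_closedSpan 𝕜 f _)] at h3
    refine le_trans ?_ h3
    have h4 : ‖y‖ ^ 2 ≤ ‖V.starProjection z‖ * ‖v‖ := by
      have : (‖y‖ : 𝕜) ^ 2 = inner 𝕜 (V.starProjection z) v := by
        rw [← inner_self_eq_norm_sq_to_K, ← e2 v hv, ContinuousLinearMap.adjoint_inner_left, hTv]
      calc ‖y‖ ^ 2 = ‖(‖y‖ : 𝕜) ^ 2‖ := by simp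
        _ ≤ _ := by
          rw [this]
          exact norm_inner_le_norm _ _
    have h5 : ‖y‖ ≤ K * ‖V.starProjection z‖ := by
      rcases eq_or_lt_of_le (norm_nonneg y) with h0 | h0
      · rw [← h0]
        positivity
      · refine le_of_mul_le_mul_right ?_ h0
        calc ‖y‖ * ‖y‖ = ‖y‖ ^ 2 := by ring
          _ ≤ ‖V.starProjection z‖ * (K * ‖y‖) := h4.trans (by gcongr)
          _ = _ := by ring
    rw [div_mul_eq_mul_div, div_le_iff₀ (by positivity), mul_assoc, ← mul_pow,
      mul_comm _ K]
    gcongr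
  · rw [mul_assoc, ← mul_pow]
    gcongr

lemma IsFrameSequence.map [CompleteSpace H] {f : ι → H} (h : IsFrameSequence 𝕜 f)
    (T : H ≃L[𝕜] H) : IsFrameSequence 𝕜 (fun i => T (f i)) := by
  obtain ⟨A, B, hA, hB, h⟩ := h
  exact ⟨_, _, by positivity, by positivity, h.map hA.le hB.le T⟩

lemma HasSubframeProperty.map [CompleteSpace H] {f : ι → H} (h : HasSubframeProperty 𝕜 f)
    (T : H ≃L[𝕜] H) : HasSubframeProperty 𝕜 (fun i => T (f i)) := fun s => (h s).map T

lemma isFrame_iff [CompleteSpace H] {f : ι → H} :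
    IsFrame 𝕜 f ↔ closedSpan 𝕜 f = ⊤ ∧ IsFrameSequence 𝕜 f := by
  refine ⟨fun h => ?_, fun ⟨h1, h2⟩ => by
    unfold IsFrameSequence at h2
    rwa [h1] at h2⟩
  have h1 : closedSpan 𝕜 f = ⊤ := by
    obtain ⟨A, B, hA, -, h⟩ := h
    refine (Submodule.topologicalClosure_eq_top_iff).2 ((Submodule.eq_bot_iff _).2 fun x hx => ?_)
    have h2 : ∀ i, inner 𝕜 x (f i) = 0 := fun i =>
      (Submodule.mem_orthogonal' _ x).1 hx _ (Submodule.subset_span ⟨i, rfl⟩)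
    have h3 := (h x trivial).2.1
    simp only [h2, norm_zero, ne_eq, OfNat.ofNat_ne_zero, not_false_eq_true, zero_pow,
      tsum_zero] at h3
    by_contra hne
    have : 0 < A * ‖x‖ ^ 2 := by positivity
    linarith
  refine ⟨h1, ?_⟩
  unfold IsFrameSequence
  rw [h1]
  exact h

/-- The frame inequality for `H` itself is the case of the full index set. -/
lemma isRieszFrame_iff [CompleteSpace H] {f : ι → H} :
    IsRieszFrame 𝕜 f ↔ closedSpan 𝕜 f = ⊤ ∧ ∃ A B : ℝ, 0 < A ∧ 0 < B ∧
      ∀ s : Set ι, HasFrameBounds A B (fun i : s => f i) (closedSpan 𝕜 (fun i : s => f i)) := by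
  refine ⟨fun ⟨h1, h2⟩ => ⟨(isFrame_iff.1 h1).1, h2⟩, fun ⟨h1, A, B, hA, hB, h⟩ =>
    ⟨isFrame_iff.2 ⟨h1, A, B, hA, hB, ?_⟩, A, B, hA, hB, h⟩⟩
  have h2 := h Set.univ
  have h0 : ∀ i ∉ Set.range (Subtype.val : ↥(Set.univ : Set ι) → ι), f i = 0 := fun i hi =>
    absurd ⟨⟨i, trivial⟩, rfl⟩ hi
  rwa [hasFrameBounds_comp Subtype.val_injective h0, closedSpan_comp h0] at h2

lemma IsRieszFrame.map [CompleteSpace H] {f : ι → H} (h : IsRieszFrame 𝕜 f)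
    (T : H ≃L[𝕜] H) : IsRieszFrame 𝕜 (fun i => T (f i)) := by
  obtain ⟨h1, A, B, hA, hB, h⟩ := isRieszFrame_iff.1 h
  exact isRieszFrame_iff.2 ⟨closedSpan_map_eq_top T h1, _, _, by positivity, by positivity,
    fun s => (h s).map hA.le hB.le T⟩

lemma IsRieszBasis.map {g : ι → H} (h : IsRieszBasis 𝕜 g) (T : H ≃L[𝕜] H) :
    IsRieszBasis 𝕜 (fun i => T (g i)) := by
  obtain ⟨h1, c, C, hc, hC, h⟩ := h
  refine ⟨closedSpan_map_eq_top T h1, c / (‖(T.symm : H →L[𝕜] H)‖ + 1),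
    (‖(T : H →L[𝕜] H)‖ + 1) * C, by positivity, by positivity, fun s a => ?_⟩
  have e : ∑ i ∈ s, a i • T (g i) = T (∑ i ∈ s, a i • g i) := by simp
  rw [e]
  obtain ⟨h2, h3⟩ := h s a
  set x := ∑ i ∈ s, a i • g i
  constructor
  · rw [div_mul_eq_mul_div, div_le_iff₀ (by positivity)]
    refine h2.trans ?_
    have := (T.symm : H →L[𝕜] H).le_opNorm (T x)
    simp only [ContinuousLinearEquiv.coe_coe, ContinuousLinearEquiv.symm_apply_apply] at this
    nlinarith [norm_nonneg (T x)]
  · have := (T : H →L[𝕜] H).le_opNorm x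
    simp only [ContinuousLinearEquiv.coe_coe] at this
    rw [mul_assoc]
    exact this.trans (by gcongr; simp)

lemma IsSplitting.map [CompleteSpace H] {f : ι → H} {I Γ Λ : Set ι} {F : Finset ι} {h₁ h₂ : ι → H}
    (h : IsSplitting 𝕜 f I Γ Λ F h₁ h₂) (T : H ≃L[𝕜] H) :
    IsSplitting 𝕜 (fun i => T (f i)) I Γ Λ F (fun i => T (h₁ i)) (fun i => T (h₂ i)) where
  cover := h.cover
  disjoint_I_Γ := h.disjoint_I_Γ
  disjoint_I_Λ := h.disjoint_I_Λ
  disjoint_Γ_Λ := h.disjoint_Γ_Λ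
  finite_Λ := h.finite_Λ
  F_subset := h.F_subset
  rieszBasis := h.rieszBasis.map T
  infiniteSupport := fun i hi => by
    obtain ⟨a, ha, hinf⟩ := h.infiniteSupport i hi
    refine ⟨a, ?_, hinf⟩
    simpa using ha.mapL (T : H →L[𝕜] H)
  eq_add := fun i hi => by rw [h.eq_add i hi, map_add]
  mem_G := fun i hi => by
    have := Submodule.mem_map_of_mem (f := (T : H →ₗ[𝕜] H)) (h.mem_G i hi)
    rw [Submodule.map_span, ← Set.image_comp] at this
    exact this
  summable := by
    refine (h.summable.mul_left (‖(T : H →L[𝕜] H)‖ ^ 2)).of_nonneg_of_le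
      (fun _ => by positivity) fun i => ?_
    rw [← mul_pow]
    gcongr
    exact (T : H →L[𝕜] H).le_opNorm _
  rieszFrame := by
    have := h.rieszFrame.map T
    convert this using 2 with i
    rcases i with i | i <;> rfl

/-! ### Splittings imply the subframe property -/

/-- Outside the Riesz frame formed by the `f i`, `i ∈ I`, and the `h₁ i`, `i ∈ Γ`, the family `f`
consists of the vectors `h₂ i` and `f i`, `i ∈ Λ`, which span a finite-dimensional space. -/
lemma IsSplitting.hasSubframeProperty [CompleteSpace H] {f : ι → H} {I Γ Λ : Set ι} {F : Finset ι}
    {h₁ h₂ : ι → H} (h : IsSplitting 𝕜 f I Γ Λ F h₁ h₂) : HasSubframeProperty 𝕜 f := by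
  classical
  set u : ι → H := fun i => if i ∈ I then f i else if i ∈ Γ then h₁ i else 0 with hu
  set v : ι → H := fun i => if i ∈ I then 0 else if i ∈ Γ then h₂ i else f i with hv
  have huI : ∀ i ∈ I, u i = f i := fun i hi => by simp [hu, hi]
  have hIΓ : ∀ i ∈ Γ, i ∉ I := fun i hi hi' => Set.disjoint_left.1 h.disjoint_I_Γ hi' hi
  have huΓ : ∀ i ∈ Γ, u i = h₁ i := fun i hi => by simp [hu, hi, hIΓ i hi]
  have hfuv : ∀ i, f i = u i + v i := fun i => by
    by_cases h1 : i ∈ I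
    · simp [hu, hv, h1]
    · by_cases h2 : i ∈ Γ
      · simp [hu, hv, h1, h2, h.eq_add i h2]
      · simp [hu, hv, h1, h2]
  have hΛ : ∀ i, i ∉ I → i ∉ Γ → i ∈ Λ := fun i h1 h2 => by
    have : i ∈ I ∪ Γ ∪ Λ := h.cover ▸ trivial
    simpa [h1, h2] using this
  set V := Submodule.span 𝕜 (f '' (F : Set ι)) ⊔ Submodule.span 𝕜 (f '' Λ)
  have : FiniteDimensional 𝕜 (Submodule.span 𝕜 (f '' (F : Set ι))) :=
    FiniteDimensional.span_of_finite 𝕜 (F.finite_toSet.image f)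
  have : FiniteDimensional 𝕜 (Submodule.span 𝕜 (f '' Λ)) :=
    FiniteDimensional.span_of_finite 𝕜 (h.finite_Λ.image f)
  have hvV : ∀ i, v i ∈ V := fun i => by
    by_cases h1 : i ∈ I
    · simp [hv, h1]
    · by_cases h2 : i ∈ Γ
      · simp only [hv, h1, h2, if_true, if_false]
        exact Submodule.mem_sup_left (h.mem_G i h2)
      · simp only [hv, h1, h2, if_false]
        exact Submodule.mem_sup_right (Submodule.subset_span ⟨i, hΛ i h1 h2, rfl⟩)
  have hvs : Summable fun i => ‖v i‖ ^ 2 := by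
    have s1 : Summable (Γ.indicator fun i => ‖h₂ i‖ ^ 2) :=
      summable_subtype_iff_indicator.1 h.summable
    have s2 : Summable (Λ.indicator fun i => ‖f i‖ ^ 2) :=
      summable_of_hasFiniteSupport (h.finite_Λ.subset Set.support_indicator_subset)
    refine (s1.add s2).of_nonneg_of_le (fun _ => by positivity) fun i => ?_
    have n1 : 0 ≤ Γ.indicator (fun i => ‖h₂ i‖ ^ 2) i :=
      Set.indicator_nonneg (fun _ _ => by positivity) _
    have n2 : 0 ≤ Λ.indicator (fun i => ‖f i‖ ^ 2) i :=
      Set.indicator_nonneg (fun _ _ => by positivity) _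
    by_cases h1 : i ∈ I
    · simpa [hv, h1] using add_nonneg n1 n2
    · by_cases h2 : i ∈ Γ
      · simpa [hv, h1, h2] using n2
      · simp [hv, h1, h2, hΛ i h1 h2]
  obtain ⟨-, A, B, hA, hB, hRF⟩ := h.rieszFrame
  intro s
  have hus : IsFrameSequence 𝕜 (fun i : s => u i) := by
    set e : I ⊕ Γ → ι := Sum.elim Subtype.val Subtype.val with he
    have hue : ∀ j, u (e j) = Sum.elim (fun i : I => f i) (fun i : Γ => h₁ i) j := by
      rintro (i | i)
      · exact huI i i.2
      · exact huΓ i i.2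
    have hinj : Function.Injective e :=
      Subtype.val_injective.sumElim Subtype.val_injective fun i j hij =>
        hIΓ j j.2 (hij ▸ i.2)
    let φ : (e ⁻¹' s) → s := fun j => ⟨e j, j.2⟩
    have hφ : Function.Injective φ := fun j k hjk =>
      Subtype.ext (hinj (congrArg Subtype.val hjk))
    have h0 : ∀ i ∉ Set.range φ, u (i : s) = 0 := fun i hi => by
      have hi1 : (i : ι) ∉ I := fun hI => hi ⟨⟨Sum.inl ⟨i, hI⟩, i.2⟩, rfl⟩
      have hi2 : (i : ι) ∉ Γ := fun hΓ => hi ⟨⟨Sum.inr ⟨i, hΓ⟩, i.2⟩, rfl⟩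
      simp [hu, hi1, hi2]
    have h3 := hRF (e ⁻¹' s)
    simp only [← hue] at h3
    rw [show (fun i : (e ⁻¹' s) => u (e i)) = fun i => (fun i : s => u i) (φ i) from rfl,
      hasFrameBounds_comp (w := fun i : s => u i) hφ h0,
      closedSpan_comp (w := fun i : s => u i) h0] at h3
    exact ⟨A, B, hA, hB, h3⟩
  have := hus.add_of_finiteDimensional V (fun i => hvV i) (hvs.subtype s)
  simpa only [← hfuv] using this

/-! ### Uniformly bounded expansions -/

variable (𝕜) in
/-- `x` is a finite linear combination of the `f i` with `i ∈ s`, the squared ℓ²-norm of the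
coefficients being at most `R`. -/
def HasExpansion (f : ι → H) (s : Set ι) (R : ℝ) (x : H) : Prop :=
  ∃ a : ι →₀ 𝕜, a ∈ Finsupp.supported 𝕜 𝕜 s ∧ Finsupp.linearCombination 𝕜 f a = x ∧
    ∑ i ∈ a.support, ‖a i‖ ^ 2 ≤ R

variable (𝕜) in
/-- Every `x` in the (algebraic) span of the `f i`, `i ∈ s`, is a finite linear combination of these
vectors with coefficients of squared ℓ²-norm at most `C ‖x‖²`. This is the form dual to the lower
frame inequality with constant `1 / C`. -/
def HasStableExpansions (C : ℝ) (f : ι → H) (s : Set ι) : Prop :=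
  ∀ x ∈ Submodule.span 𝕜 (f '' s), HasExpansion 𝕜 f s (C * ‖x‖ ^ 2) x

lemma HasExpansion.mono {f : ι → H} {s t : Set ι} {R R' : ℝ} {x : H}
    (h : HasExpansion 𝕜 f s R x) (hst : s ⊆ t) (hR : R ≤ R') : HasExpansion 𝕜 f t R' x := by
  obtain ⟨a, h1, h2, h3⟩ := h
  exact ⟨a, Finsupp.supported_mono hst h1, h2, h3.trans hR⟩

lemma HasExpansion.of_finset {f : ι → H} {x : H} (s : Finset ι) (b : ι → 𝕜)
    (hx : ∑ i ∈ s, b i • f i = x) : HasExpansion 𝕜 f s (∑ i ∈ s, ‖b i‖ ^ 2) x := by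
  classical
  refine ⟨Finsupp.onFinset s (fun i => if i ∈ s then b i else 0) fun i hi => ?_, ?_, ?_, ?_⟩
  · by_contra h
    simp [h] at hi
  · rw [Finsupp.mem_supported]
    exact_mod_cast Finsupp.support_onFinset_subset
  · rw [Finsupp.linearCombination_apply,
      Finsupp.onFinset_sum (g := fun i c => c • f i) _ (fun i => zero_smul _ _), ← hx]
    exact Finset.sum_congr rfl fun i hi => by simp [hi]
  · refine (Finset.sum_le_sum_of_subset_of_nonneg Finsupp.support_onFinset_subset
      fun _ _ _ => by positivity).trans_eq ?_
    exact Finset.sum_congr rfl fun i hi => by simp [hi]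

lemma HasExpansion.add {f : ι → H} {s t : Set ι} {R R' : ℝ} {x y : H}
    (hx : HasExpansion 𝕜 f s R x) (hy : HasExpansion 𝕜 f t R' y) :
    HasExpansion 𝕜 f (s ∪ t) (2 * (R + R')) (x + y) := by
  classical
  obtain ⟨a, h1, h2, h3⟩ := hx
  obtain ⟨b, k1, k2, k3⟩ := hy
  refine ⟨a + b, add_mem (Finsupp.supported_mono Set.subset_union_left h1)
    (Finsupp.supported_mono Set.subset_union_right k1), by rw [map_add, h2, k2], ?_⟩
  have e : ∀ (c : ι →₀ 𝕜) (u : Finset ι), c.support ⊆ u →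
      ∑ i ∈ u, ‖c i‖ ^ 2 = ∑ i ∈ c.support, ‖c i‖ ^ 2 := fun c u hu =>
    (Finset.sum_subset hu fun i _ hi => by simp [Finsupp.notMem_support_iff.1 hi]).symm
  rw [← e (a + b) (a.support ∪ b.support) Finsupp.support_add]
  rw [← e a (a.support ∪ b.support) Finset.subset_union_left] at h3
  rw [← e b (a.support ∪ b.support) Finset.subset_union_right] at k3
  calc ∑ i ∈ a.support ∪ b.support, ‖(a + b) i‖ ^ 2
      ≤ ∑ i ∈ a.support ∪ b.support, 2 * (‖a i‖ ^ 2 + ‖b i‖ ^ 2) := by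
        refine Finset.sum_le_sum fun i _ => ?_
        have : ‖(a + b) i‖ ≤ ‖a i‖ + ‖b i‖ := norm_add_le _ _
        have h2 : ‖(a + b) i‖ ^ 2 ≤ (‖a i‖ + ‖b i‖) ^ 2 := by gcongr
        nlinarith [sq_nonneg (‖a i‖ - ‖b i‖)]
    _ ≤ _ := by
        rw [← Finset.mul_sum, Finset.sum_add_distrib]
        gcongr

lemma HasStableExpansions.hasFrameBounds {C B : ℝ} (hC : 0 < C) {f : ι → H}
    (hB : IsBessel 𝕜 B f) {s : Set ι} (h : HasStableExpansions 𝕜 C f s) :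
    HasFrameBounds (1 / C) B (fun i : s => f i) (closedSpan 𝕜 (fun i : s => f i)) := by
  have hBs : IsBessel 𝕜 B (fun i : s => f i) := hB.comp Subtype.val_injective
  obtain ⟨Θ, hΘ⟩ := hBs.exists_analysis
  have key : ∀ x ∈ Submodule.span 𝕜 (Set.range fun i : s => f i), ‖x‖ ^ 2 ≤ C * ‖Θ x‖ ^ 2 := by
    intro x hx
    rw [← Set.image_eq_range] at hx
    obtain ⟨a, h1, h2, h3⟩ := h x hx
    have h4 := sq_norm_sum_smul_le x f a.support a
      (by rw [← h2, Finsupp.linearCombination_apply]; rfl)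
    have h5 : ∑ i ∈ a.support, ‖inner 𝕜 x (f i)‖ ^ 2 ≤ ‖Θ x‖ ^ 2 := by
      rw [← (hasSum_sq_norm_analysis hΘ x).tsum_eq]
      classical
      rw [← Finset.sum_subtype_of_mem (fun i => ‖inner 𝕜 x (f i)‖ ^ 2)
        (p := (· ∈ s)) fun i hi => (Finsupp.mem_supported _ _).1 h1 hi]
      exact (hBs x).1.sum_le_tsum _ fun _ _ => by positivity
    have h6 : ‖x‖ ^ 4 ≤ (C * ‖x‖ ^ 2) * ‖Θ x‖ ^ 2 := h4.trans (by gcongr)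
    rcases eq_or_lt_of_le (sq_nonneg ‖x‖) with h0 | h0
    · rw [← h0]
      positivity
    · exact le_of_mul_le_mul_right (by nlinarith) h0
  intro x hx
  refine ⟨(hBs x).1, ?_, (hBs x).2⟩
  rw [(hasSum_sq_norm_analysis hΘ x).tsum_eq, one_div, inv_mul_le_iff₀ hC]
  have hcl : IsClosed {x : H | ‖x‖ ^ 2 ≤ C * ‖Θ x‖ ^ 2} :=
    isClosed_le (by fun_prop) (by fun_prop)
  exact closure_minimal key hcl hx

/-- For a finite family, the frame operator is invertible on the span, and it provides stable
expansions as soon as a lower frame inequality holds. -/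
lemma hasStableExpansions_of_lower_bound {c : ℝ} (hc : 0 < c) {f : ι → H} (s : Finset ι)
    (h : ∀ x ∈ Submodule.span 𝕜 (f '' (s : Set ι)),
      c * ‖x‖ ^ 2 ≤ ∑ i ∈ s, ‖inner 𝕜 x (f i)‖ ^ 2) :
    HasStableExpansions 𝕜 (1 / c) f s := by
  set V := Submodule.span 𝕜 (f '' (s : Set ι)) with hV
  have hfin : FiniteDimensional 𝕜 V := FiniteDimensional.span_of_finite 𝕜 (s.finite_toSet.image f)
  let S : H →ₗ[𝕜] H := ∑ i ∈ s, (innerₛₗ 𝕜 (f i)).smulRight (f i)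
  have hS : ∀ x, S x = ∑ i ∈ s, inner 𝕜 (f i) x • f i := fun x => by
    simp [S, LinearMap.sum_apply]
  have hSV : ∀ x ∈ V, S x ∈ V := fun x _ => by
    rw [hS]
    exact Submodule.sum_mem _ fun i hi =>
      Submodule.smul_mem _ _ (Submodule.subset_span ⟨i, hi, rfl⟩)
  have hquad : ∀ y, inner 𝕜 y (S y) = ((∑ i ∈ s, ‖inner 𝕜 (f i) y‖ ^ 2 : ℝ) : 𝕜) := fun y => by
    rw [hS, inner_sum]
    push_cast
    refine Finset.sum_congr rfl fun i _ => ?_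
    rw [inner_smul_right, ← inner_conj_symm y (f i), RCLike.mul_conj]
  have hn : ∀ y ∈ V, c * ‖y‖ ^ 2 ≤ ∑ i ∈ s, ‖inner 𝕜 (f i) y‖ ^ 2 := fun y hy => by
    simpa only [norm_inner_symm] using h y hy
  have hinj : Function.Injective (S.restrict hSV) := by
    refine (injective_iff_map_eq_zero _).2 fun y hy => ?_
    have h1 : S y = 0 := congrArg Subtype.val hy
    have h2 := hquad y
    rw [h1, inner_zero_right] at h2
    have h3 : (∑ i ∈ s, ‖inner 𝕜 (f i) (y : H)‖ ^ 2 : ℝ) = 0 := by exact_mod_cast h2.symm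
    have h4 := hn y y.2
    rw [h3] at h4
    by_contra hne
    have : (y : H) ≠ 0 := fun h => hne (Subtype.ext h)
    have : 0 < c * ‖(y : H)‖ ^ 2 := by positivity
    linarith
  intro x hx
  obtain ⟨y, hy⟩ := (LinearMap.injective_iff_surjective.1 hinj) ⟨x, hx⟩
  have hSy : S y = x := congrArg Subtype.val hy
  refine (HasExpansion.of_finset s (fun i => inner 𝕜 (f i) (y : H)) (by rw [← hS, hSy])).mono
    le_rfl ?_
  have h1 := hn y y.2
  have h2 := hquad y
  set σ := ∑ i ∈ s, ‖inner 𝕜 (f i) (y : H)‖ ^ 2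
  have h0 : 0 ≤ σ := Finset.sum_nonneg fun _ _ => by positivity
  have h3 : σ ≤ ‖(y : H)‖ * ‖x‖ := by
    calc σ = ‖((σ : ℝ) : 𝕜)‖ := by rw [RCLike.norm_ofReal, abs_of_nonneg h0]
      _ ≤ _ := by
        rw [← h2, hSy]
        exact norm_inner_le_norm _ _
  rw [one_div, ← div_eq_inv_mul, le_div_iff₀ hc]
  rcases eq_or_lt_of_le h0 with h4 | h4
  · rw [← h4, zero_mul]
    positivity
  · have h5 : σ ^ 2 ≤ (‖(y : H)‖ * ‖x‖) ^ 2 := by gcongr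
    refine le_of_mul_le_mul_right ?_ h4
    calc σ * c * σ = c * σ ^ 2 := by ring
      _ ≤ c * (‖(y : H)‖ * ‖x‖) ^ 2 := by gcongr
      _ = c * ‖(y : H)‖ ^ 2 * ‖x‖ ^ 2 := by ring
      _ ≤ σ * ‖x‖ ^ 2 := by gcongr
      _ = _ := by ring

/-- Adjoining a vector `f m` at positive distance from a closed subspace preserves stability of
expansions, uniformly for all subfamilies inside this subspace. -/
lemma exists_hasStableExpansions_insert {f : ι → H} {V : Submodule 𝕜 H} (hV : IsClosed (V : Set H))
    {m : ι} (hm : f m ∉ V) {C : ℝ} (hC : 0 < C) :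
    ∃ C' > 0, ∀ t : Set ι, f '' t ⊆ V → HasStableExpansions 𝕜 C f t →
      HasStableExpansions 𝕜 C' f (insert m t) := by
  set d := Metric.infDist (f m) (V : Set H)
  have hd : 0 < d := (hV.notMem_iff_infDist_pos ⟨0, V.zero_mem⟩).1 hm
  have hc : ∀ (c : 𝕜), ∀ y ∈ V, ‖c‖ * d ≤ ‖c • f m + y‖ := fun c y hy => by
    by_cases h0 : c = 0
    · simp [h0]
    · have h1 : d ≤ dist (f m) (-(c⁻¹ • y)) :=
        Metric.infDist_le_dist_of_mem (V.neg_mem (V.smul_mem _ hy))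
      have h2 : c • f m + y = c • (f m - -(c⁻¹ • y)) := by
        rw [sub_neg_eq_add, smul_add, smul_inv_smul₀ h0]
      rw [h2, norm_smul, ← dist_eq_norm]
      gcongr
  set K := 1 + ‖f m‖ / d with hK
  refine ⟨2 * ((1 / d) ^ 2 + C * K ^ 2), by positivity, fun t htV ht x hx => ?_⟩
  rw [Set.image_insert_eq] at hx
  obtain ⟨c, y, hy, rfl⟩ := Submodule.mem_span_insert.1 hx
  have hyV : y ∈ V := Submodule.span_le.2 htV hy
  set x := c • f m + y with hxdef
  have h1 := hc c y hyV
  have h1' : ‖c‖ ≤ 1 / d * ‖x‖ := by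
    rw [one_div_mul_eq_div, le_div_iff₀ hd]
    exact h1
  have h2 : ‖y‖ ≤ K * ‖x‖ := by
    have : y = x - c • f m := by simp [hxdef]
    calc ‖y‖ ≤ ‖x‖ + ‖c • f m‖ := by
          rw [this]
          exact norm_sub_le _ _
      _ ≤ ‖x‖ + 1 / d * ‖x‖ * ‖f m‖ := by
          rw [norm_smul]
          gcongr
      _ = K * ‖x‖ := by
          rw [hK]
          ring
  have e1 : HasExpansion 𝕜 f {m} (‖c‖ ^ 2) (c • f m) := by
    have := HasExpansion.of_finset (f := f) {m} (fun _ => c) rfl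
    simpa using this
  refine (e1.add (ht y hy)).mono (by rw [Set.singleton_union]) ?_
  calc 2 * (‖c‖ ^ 2 + C * ‖y‖ ^ 2) ≤ 2 * ((1 / d * ‖x‖) ^ 2 + C * (K * ‖x‖) ^ 2) := by gcongr
    _ = _ := by ring

lemma exists_hasStableExpansions_of_finite (f : ι → H) {s : Set ι} (hs : s.Finite) :
    ∃ C > 0, HasStableExpansions 𝕜 C f s := by
  induction s, hs using Set.Finite.induction_on with
  | empty =>
    refine ⟨1, one_pos, fun x hx => ⟨0, zero_mem _, ?_, by simp⟩⟩
    rw [Set.image_empty, Submodule.span_empty, Submodule.mem_bot] at hx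
    rw [hx, map_zero]
  | @insert m s _ hs ih =>
    obtain ⟨C, hC, h⟩ := ih
    have : FiniteDimensional 𝕜 (Submodule.span 𝕜 (f '' s)) :=
      FiniteDimensional.span_of_finite 𝕜 (hs.image f)
    by_cases hm : f m ∈ Submodule.span 𝕜 (f '' s)
    · refine ⟨C, hC, fun x hx => ?_⟩
      rw [Set.image_insert_eq, Submodule.span_insert_eq_span hm] at hx
      exact (h x hx).mono (Set.subset_insert _ _) le_rfl
    · obtain ⟨C', hC', h'⟩ := exists_hasStableExpansions_insert
        (Submodule.closed_of_finiteDimensional (Submodule.span 𝕜 (f '' s))) hm hC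
      exact ⟨C', hC', h' s Submodule.subset_span h⟩

/-- In stable expansions over index sets `E ∪ t`, the part `E` may be replaced by any finite `F`
with the same span, at the cost of a constant not depending on `t`. -/
lemma exists_hasStableExpansions_replace {f : ι → H} {B : ℝ} (hB0 : 0 ≤ B) (hB : IsBessel 𝕜 B f)
    {E F : Set ι} (hF : F.Finite) (hEF : Submodule.span 𝕜 (f '' E) = Submodule.span 𝕜 (f '' F))
    {C : ℝ} (hC : 0 < C) :
    ∃ C' > 0, ∀ t : Set ι, HasStableExpansions 𝕜 C f (E ∪ t) →
      HasStableExpansions 𝕜 C' f (F ∪ t) := by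
  classical
  obtain ⟨C₀, hC₀, h₀⟩ := exists_hasStableExpansions_of_finite (𝕜 := 𝕜) f hF
  refine ⟨2 * (C₀ * (B * C) + C), by positivity, fun t ht x hx => ?_⟩
  rw [Set.image_union, Submodule.span_union, ← hEF, ← Submodule.span_union, ← Set.image_union] at hx
  obtain ⟨a, h1, h2, h3⟩ := ht x hx
  have hsup := (Finsupp.mem_supported _ _).1 h1
  set s₁ := a.support.filter (· ∈ E) with hs₁
  set s₂ := a.support.filter (¬ · ∈ E) with hs₂
  set y := ∑ i ∈ s₁, a i • f i with hy
  set z := ∑ i ∈ s₂, a i • f i with hz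
  have hx' : y + z = x := by
    rw [← h2, Finsupp.linearCombination_apply, hy, hz]
    exact Finset.sum_filter_add_sum_filter_not _ _ _
  have hn1 : ∑ i ∈ s₁, ‖a i‖ ^ 2 ≤ C * ‖x‖ ^ 2 := (Finset.sum_le_sum_of_subset_of_nonneg
    (Finset.filter_subset _ _) fun _ _ _ => by positivity).trans h3
  have hn2 : ∑ i ∈ s₂, ‖a i‖ ^ 2 ≤ C * ‖x‖ ^ 2 := (Finset.sum_le_sum_of_subset_of_nonneg
    (Finset.filter_subset _ _) fun _ _ _ => by positivity).trans h3
  have hyF : y ∈ Submodule.span 𝕜 (f '' F) := by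
    rw [← hEF]
    exact Submodule.sum_mem _ fun i hi => Submodule.smul_mem _ _
      (Submodule.subset_span ⟨i, (Finset.mem_filter.1 hi).2, rfl⟩)
  have hyn : ‖y‖ ^ 2 ≤ B * (C * ‖x‖ ^ 2) := (hB.sq_norm_sum_le hB0 s₁ a).trans (by gcongr)
  have e2 : HasExpansion 𝕜 f t (C * ‖x‖ ^ 2) z :=
    (HasExpansion.of_finset s₂ a rfl).mono (fun i hi => by
      obtain ⟨hi1, hi2⟩ := Finset.mem_filter.1 hi
      exact (hsup hi1).resolve_left hi2) hn2
  rw [← hx'] at *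
  refine ((h₀ y hyF).add e2).mono le_rfl ?_
  calc 2 * (C₀ * ‖y‖ ^ 2 + C * ‖y + z‖ ^ 2)
      ≤ 2 * (C₀ * (B * (C * ‖y + z‖ ^ 2)) + C * ‖y + z‖ ^ 2) := by gcongr
    _ = _ := by ring

/-! ### Stable expansions from the subframe property -/

/-- If stability of expansions fails arbitrarily far out whatever finite set of indices is fixed in
advance, then any finite set can be enlarged so as to carry a vector violating a given lower frame
inequality, even after adding indices that are large enough. -/
lemma exists_lower_bound_violation {f : ℕ → H} {B : ℝ} (hB : IsBessel 𝕜 B f)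
    (hneg : ∀ (E : Finset ℕ) (N : ℕ) (C : ℝ), 0 < C →
      ∃ t ⊆ Set.Ici N, ¬ HasStableExpansions 𝕜 C f (E ∪ t))
    (E : Finset ℕ) (N : ℕ) {ε : ℝ} (hε : 0 < ε) :
    ∃ (E' : Finset ℕ) (N' : ℕ) (x : H), E ⊆ E' ∧ (∀ i ∈ E', i ∉ E → N ≤ i) ∧ N ≤ N' ∧ x ≠ 0 ∧
      x ∈ Submodule.span 𝕜 (f '' (E' : Set ℕ)) ∧
      ∑ i ∈ E', ‖inner 𝕜 x (f i)‖ ^ 2 < ε * ‖x‖ ^ 2 ∧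
      ∀ T : Finset ℕ, (∀ i ∈ T, N' ≤ i) → ∑ i ∈ T, ‖inner 𝕜 x (f i)‖ ^ 2 < ε * ‖x‖ ^ 2 := by
  classical
  obtain ⟨t, htN, ht⟩ := hneg E N (1 / ε) (by positivity)
  unfold HasStableExpansions at ht
  push Not at ht
  obtain ⟨x₀, hx₀, hno⟩ := ht
  obtain ⟨a, ha, rfl⟩ := (Finsupp.mem_span_image_iff_linearCombination 𝕜).1 hx₀
  have hsup := (Finsupp.mem_supported _ _).1 ha
  set E' := E ∪ a.support with hE'
  have hE't : (E' : Set ℕ) ⊆ E ∪ t := by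
    rw [hE', Finset.coe_union]
    exact Set.union_subset Set.subset_union_left hsup
  have hx₀' : Finsupp.linearCombination 𝕜 f a ∈ Submodule.span 𝕜 (f '' (E' : Set ℕ)) :=
    (Finsupp.mem_span_image_iff_linearCombination 𝕜).2
      ⟨a, (Finsupp.mem_supported _ _).2 (by simp [hE']), rfl⟩
  have hfail : ¬ ∀ x ∈ Submodule.span 𝕜 (f '' (E' : Set ℕ)),
      ε * ‖x‖ ^ 2 ≤ ∑ i ∈ E', ‖inner 𝕜 x (f i)‖ ^ 2 := fun h =>
    hno ((hasStableExpansions_of_lower_bound hε E' h _ hx₀').mono hE't le_rfl)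
  push Not at hfail
  obtain ⟨x, hx, hlt⟩ := hfail
  have hpos : 0 < ε * ‖x‖ ^ 2 :=
    (Finset.sum_nonneg fun _ _ => by positivity).trans_lt hlt
  obtain ⟨s₀, hs₀⟩ := summable_iff_vanishing_norm.1 (hB x).1 _ hpos
  refine ⟨E', max N (s₀.sup id + 1), x, Finset.subset_union_left, fun i hi hiE => ?_,
    le_max_left _ _, ?_, hx, hlt, fun T hT => ?_⟩
  · exact htN ((hE't hi).resolve_left hiE)
  · rintro rfl
    simp at hpos
  · refine (le_abs_self _).trans_lt (hs₀ T (Finset.disjoint_left.2 fun i hi hi' => ?_))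
    have h1 := (le_max_right _ _).trans (hT i hi)
    have h2 : i ≤ s₀.sup id := Finset.le_sup (f := id) hi'
    omega

/-- A gliding hump argument: otherwise, iterating `exists_lower_bound_violation` would produce a
subfamily with no lower frame bound. -/
lemma HasSubframeProperty.exists_uniform {f : ℕ → H} {B : ℝ} (hB : IsBessel 𝕜 B f)
    (h : HasSubframeProperty 𝕜 f) :
    ∃ (E : Finset ℕ) (N : ℕ) (C : ℝ), 0 < C ∧
      ∀ t ⊆ Set.Ici N, HasStableExpansions 𝕜 C f (E ∪ t) := by
  classical
  by_contra hcon
  push Not at hcon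
  have hstep := fun (p : Finset ℕ × ℕ) (k : ℕ) =>
    exists_lower_bound_violation hB hcon p.1 p.2 (ε := 1 / ((k : ℝ) + 1)) (by positivity)
  choose nE nN X hsub hnew hN hX0 hXspan hX1 hX2 using hstep
  let P : ℕ → Finset ℕ × ℕ := Nat.rec (∅, 0) fun k p => (nE p k, nN p k)
  have hP : ∀ k, P (k + 1) = (nE (P k) k, nN (P k) k) := fun k => rfl
  have hNmono : Monotone fun k => (P k).2 := monotone_nat_of_le_succ fun k => hN (P k) k
  have hEmono : Monotone fun k => (P k).1 := monotone_nat_of_le_succ fun k => hsub (P k) k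
  have hfar : ∀ k l, ∀ i ∈ (P l).1, i ∉ (P k).1 → (P k).2 ≤ i := by
    intro k l
    induction l with
    | zero => intro i hi; exact absurd hi (Finset.notMem_empty i)
    | succ l ih =>
      intro i hi hik
      by_cases hil : i ∈ (P l).1
      · exact ih i hil hik
      · have hkl : k ≤ l := by
          by_contra hlt
          exact hik (hEmono (by omega : l + 1 ≤ k) hi)
        exact (hNmono hkl).trans (hnew (P l) l i hi hil)
  set s : Set ℕ := ⋃ k, ((P k).1 : Set ℕ) with hs
  obtain ⟨A, B₁, hA, -, hAB⟩ := h s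
  obtain ⟨k, hk⟩ := exists_nat_one_div_lt (half_pos hA)
  set x := X (P k) k
  have hxs : x ∈ closedSpan 𝕜 (fun i : s => f i) := by
    refine Submodule.le_topologicalClosure _ ?_
    rw [← Set.image_eq_range]
    exact Submodule.span_mono
      (Set.image_mono (Set.subset_iUnion (fun k => ((P k).1 : Set ℕ)) (k + 1)))
      (hXspan (P k) k)
  have h1 := (hAB x hxs).2.1
  have h2 : ∑' i : s, ‖inner 𝕜 x (f i)‖ ^ 2 ≤ 2 * (1 / ((k : ℝ) + 1)) * ‖x‖ ^ 2 := by
    refine Real.tsum_le_of_sum_le (fun i => by positivity) fun u => ?_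
    have e : ∑ i ∈ u, ‖inner 𝕜 x (f i)‖ ^ 2 =
        ∑ i ∈ u.map (Function.Embedding.subtype _), ‖inner 𝕜 x (f i)‖ ^ 2 := by
      simp
    rw [e, ← Finset.sum_filter_add_sum_filter_not _ (· ∈ (P (k + 1)).1)]
    have a1 : ∑ i ∈ (u.map (Function.Embedding.subtype _)).filter (· ∈ (P (k + 1)).1),
        ‖inner 𝕜 x (f i)‖ ^ 2 ≤ 1 / ((k : ℝ) + 1) * ‖x‖ ^ 2 :=
      (Finset.sum_le_sum_of_subset_of_nonneg (fun i hi => (Finset.mem_filter.1 hi).2)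
        fun _ _ _ => by positivity).trans (hX1 (P k) k).le
    have a2 := hX2 (P k) k
      ((u.map (Function.Embedding.subtype _)).filter (¬ · ∈ (P (k + 1)).1)) fun i hi => by
        obtain ⟨hi1, hi2⟩ := Finset.mem_filter.1 hi
        obtain ⟨⟨j, hj⟩, -, rfl⟩ := Finset.mem_map.1 hi1
        obtain ⟨l, hl⟩ := Set.mem_iUnion.1 hj
        exact hfar (k + 1) l j hl hi2
    linarith
  have h3 : 0 < ‖x‖ ^ 2 := by
    have := hX0 (P k) k
    positivity
  nlinarith

/-- The subframe property yields a finite `F` such that the families indexed by `F ∪ t`, `t` far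
out, have uniformly stable expansions; moreover the `f i`, `i ∈ F`, can be completed to a linearly
independent family with dense span by vectors that are far out. -/
lemma HasSubframeProperty.exists_linearIndepOn [CompleteSpace H] {f : ℕ → H} (hf : IsFrame 𝕜 f)
    (h : HasSubframeProperty 𝕜 f) :
    ∃ (F : Finset ℕ) (N : ℕ) (J : Set ℕ) (C : ℝ), 0 < C ∧ (F : Set ℕ) ⊆ J ∧
      J ⊆ F ∪ Set.Ici N ∧ LinearIndepOn 𝕜 f J ∧
      (Submodule.span 𝕜 (f '' J)).topologicalClosure = ⊤ ∧
      ∀ t ⊆ Set.Ici N, HasStableExpansions 𝕜 C f (F ∪ t) := by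
  classical
  obtain ⟨htop, hfs⟩ := isFrame_iff.1 hf
  obtain ⟨B, hB0, hB⟩ := hfs.exists_isBessel
  obtain ⟨E, N, C, hC, hE⟩ := h.exists_uniform hB
  have key : ∀ D : Finset ℕ, ∃ (F : Finset ℕ) (J : Set ℕ) (C : ℝ), 0 < C ∧ (F : Set ℕ) ⊆ J ∧
      J ⊆ F ∪ Set.Ici N ∧ LinearIndepOn 𝕜 f J ∧
      (∀ i, i ∈ D ∨ N ≤ i → f i ∈ (Submodule.span 𝕜 (f '' J)).topologicalClosure) ∧
      ∀ t ⊆ Set.Ici N, HasStableExpansions 𝕜 C f (F ∪ t) := by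
    intro D
    induction D using Finset.induction_on with
    | empty =>
      have h0 : LinearIndepOn 𝕜 f (∅ : Set ℕ) := linearIndepOn_empty _ _
      set F₀ := h0.extend (Set.empty_subset (E : Set ℕ)) with hF₀
      have hF₀E : F₀ ⊆ E := h0.extend_subset _
      have hfin : F₀.Finite := E.finite_toSet.subset hF₀E
      have hli : LinearIndepOn 𝕜 f F₀ := h0.linearIndepOn_extend _
      have hspan := h0.span_image_extend_eq_span_image (Set.empty_subset (E : Set ℕ))
      obtain ⟨C', hC', h'⟩ := exists_hasStableExpansions_replace hB0.le hB hfin hspan.symm hC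
      have hsub : F₀ ⊆ F₀ ∪ Set.Ici N := Set.subset_union_left
      refine ⟨hfin.toFinset, hli.extend hsub, C', hC', ?_, ?_,
        hli.linearIndepOn_extend hsub, ?_, ?_⟩
      · rw [hfin.coe_toFinset]
        exact hli.subset_extend hsub
      · rw [hfin.coe_toFinset]
        exact hli.extend_subset hsub
      · rintro i (hi | hi)
        · exact absurd hi (Finset.notMem_empty i)
        · refine Submodule.le_topologicalClosure _ ?_
          rw [hli.span_image_extend_eq_span_image hsub]
          exact Submodule.subset_span ⟨i, Or.inr hi, rfl⟩
      · rw [hfin.coe_toFinset]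
        exact fun t ht => h' t (hE t ht)
    | insert d D _ ih =>
      obtain ⟨F, J, C, hC, hFJ, hJ, hli, hcl, hst⟩ := ih
      set V := (Submodule.span 𝕜 (f '' J)).topologicalClosure with hV
      by_cases hd : f d ∈ V
      · refine ⟨F, J, C, hC, hFJ, hJ, hli, fun i hi => ?_, hst⟩
        rw [Finset.mem_insert, or_assoc] at hi
        rcases hi with rfl | hi
        · exact hd
        · exact hcl i hi
      · have hVc : IsClosed (V : Set H) := Submodule.isClosed_topologicalClosure _
        have hle : Submodule.span 𝕜 (f '' J) ≤ V := Submodule.le_topologicalClosure _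
        obtain ⟨C', hC', h'⟩ := exists_hasStableExpansions_insert hVc hd hC
        refine ⟨insert d F, insert d J, C', hC', ?_, ?_, hli.insert fun hd' => hd (hle hd'),
          fun i hi => ?_, fun t ht => ?_⟩
        · rw [Finset.coe_insert]
          exact Set.insert_subset_insert hFJ
        · rw [Finset.coe_insert, Set.insert_union]
          exact Set.insert_subset_insert hJ
        · rw [Finset.mem_insert, or_assoc] at hi
          rcases hi with rfl | hi
          · exact Submodule.le_topologicalClosure _
              (Submodule.subset_span ⟨i, Set.mem_insert _ _, rfl⟩)
          · exact Submodule.topologicalClosure_mono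
              (Submodule.span_mono (Set.image_mono (Set.subset_insert _ _))) (hcl i hi)
        · rw [Finset.coe_insert, Set.insert_union]
          refine h' _ ?_ (hst t ht)
          rintro _ ⟨i, hi | hi, rfl⟩
          · exact hle (Submodule.subset_span ⟨i, hFJ hi, rfl⟩)
          · exact hcl i (Or.inr (ht hi))
  obtain ⟨F, J, C, hC, hFJ, hJ, hli, hcl, hst⟩ := key (Finset.range N)
  refine ⟨F, N, J, C, hC, hFJ, hJ, hli, eq_top_iff.2 ?_, hst⟩
  rw [← htop]
  refine closedSpan_le (Submodule.isClosed_topologicalClosure _) fun i => hcl i ?_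
  rw [Finset.mem_range]
  exact lt_or_ge i N

/-! ### Riesz bases -/

lemma IsRieszBasis.exists_isBessel {g : ι → H} (hg : IsRieszBasis 𝕜 g) : ∃ B, IsBessel 𝕜 B g := by
  obtain ⟨-, c, C, -, hC, h⟩ := hg
  refine ⟨C ^ 2, fun x => ?_⟩
  have key : ∀ s : Finset ι, ∑ i ∈ s, ‖inner 𝕜 x (g i)‖ ^ 2 ≤ C ^ 2 * ‖x‖ ^ 2 := fun s => by
    set σ := ∑ i ∈ s, ‖inner 𝕜 x (g i)‖ ^ 2 with hσ
    have h0 : 0 ≤ σ := Finset.sum_nonneg fun _ _ => by positivity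
    set y := ∑ i ∈ s, inner 𝕜 (g i) x • g i with hy
    have h1 : ‖y‖ ≤ C * √σ := by
      simpa only [hσ, norm_inner_symm x] using (h s fun i => inner 𝕜 (g i) x).2
    have h2 : inner 𝕜 x y = ((σ : ℝ) : 𝕜) := by
      rw [hy, inner_sum, hσ]
      push_cast
      refine Finset.sum_congr rfl fun i _ => ?_
      rw [inner_smul_right, ← inner_conj_symm (g i) x, RCLike.conj_mul]
    have h3 : σ ≤ ‖x‖ * (C * √σ) := by
      calc σ = ‖((σ : ℝ) : 𝕜)‖ := by rw [RCLike.norm_ofReal, abs_of_nonneg h0]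
        _ ≤ ‖x‖ * ‖y‖ := by
          rw [← h2]
          exact norm_inner_le_norm _ _
        _ ≤ _ := by gcongr
    have h4 : √σ ≤ C * ‖x‖ := by
      rcases eq_or_lt_of_le (Real.sqrt_nonneg σ) with h5 | h5
      · rw [← h5]
        positivity
      · refine le_of_mul_le_mul_right ?_ h5
        rw [Real.mul_self_sqrt h0]
        linarith
    calc σ = √σ ^ 2 := (Real.sq_sqrt h0).symm
      _ ≤ (C * ‖x‖) ^ 2 := by gcongr
      _ = _ := by ring
  exact ⟨summable_of_sum_le (fun _ => by positivity) key,
    Real.tsum_le_of_sum_le (fun _ => by positivity) key⟩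

/-- The synthesis operator of a Riesz basis is an isomorphism: it is the adjoint of the analysis
operator. -/
lemma IsRieszBasis.exists_equiv [CompleteSpace H] [DecidableEq ι] {g : ι → H}
    (hg : IsRieszBasis 𝕜 g) :
    ∃ Φ : lp (fun _ : ι => 𝕜) 2 ≃L[𝕜] H, ∀ i c, Φ (lp.single 2 i c) = c • g i := by
  obtain ⟨B, hB⟩ := hg.exists_isBessel
  obtain ⟨Θ, hΘ⟩ := hB.exists_analysis
  obtain ⟨htop, c, C, hc, -, h⟩ := hg
  have hsingle : ∀ i b, Θ.adjoint (lp.single 2 i b) = b • g i := fun i b => by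
    refine ext_inner_left 𝕜 fun x => ?_
    rw [ContinuousLinearMap.adjoint_inner_right, lp.inner_single_right, hΘ, inner_smul_right,
      RCLike.inner_apply, inner_conj_symm]
  have hlow : ∀ a, c * ‖a‖ ≤ ‖Θ.adjoint a‖ := fun a => by
    have h1 := lp.hasSum_single (p := 2) (by norm_num) a
    refine le_of_tendsto_of_tendsto' (h1.norm.const_mul c)
      (((Θ.adjoint).continuous.tendsto _).comp h1).norm fun s => ?_
    have h2 := (h s a).1
    have h3 := lp.norm_sum_single (p := 2) (by norm_num) (fun i => a i) s
    have h4 : ‖∑ i ∈ s, lp.single 2 i (a i)‖ = √(∑ i ∈ s, ‖a i‖ ^ 2) := by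
      rw [← Real.sqrt_sq (norm_nonneg (∑ i ∈ s, lp.single 2 i (a i)))]
      congr 1
      simpa using h3
    simpa [h4, hsingle] using h2
  have hanti : AntilipschitzWith (Real.toNNReal (1 / c)) Θ.adjoint :=
    Θ.adjoint.antilipschitz_of_bound fun a => by
      rw [Real.coe_toNNReal _ (by positivity), one_div, ← div_eq_inv_mul, le_div_iff₀ hc, mul_comm]
      exact hlow a
  have hcl : IsClosed (Θ.adjoint.range : Set H) := hanti.isClosed_range Θ.adjoint.uniformContinuous
  have hsurj : Θ.adjoint.range = ⊤ := by
    rw [eq_top_iff, ← htop]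
    exact closedSpan_le hcl fun i => ⟨lp.single 2 i 1, by
      have := hsingle i 1
      rwa [one_smul] at this⟩
  exact ⟨ContinuousLinearEquiv.ofBijective Θ.adjoint
    (LinearMap.ker_eq_bot.2 hanti.injective) hsurj, hsingle⟩

lemma IsRieszBasis.hasInfiniteSupport [CompleteSpace H] {g : ι → H} (hg : IsRieszBasis 𝕜 g) {x : H}
    (hx : x ∉ Submodule.span 𝕜 (Set.range g)) : HasInfiniteSupport 𝕜 g x := by
  classical
  obtain ⟨Φ, hΦ⟩ := hg.exists_equiv
  have h1 := (lp.hasSum_single (p := 2) (by norm_num) (Φ.symm x)).mapL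
    (Φ : lp (fun _ : ι => 𝕜) 2 →L[𝕜] H)
  simp only [ContinuousLinearEquiv.coe_coe, ContinuousLinearEquiv.apply_symm_apply] at h1
  have h2 : HasSum (fun i => Φ.symm x i • g i) x := by
    convert h1 using 2 with i
    exact (hΦ i _).symm
  refine ⟨fun i => Φ.symm x i, h2, fun hfin => hx ?_⟩
  have h3 : HasSum (fun i => Φ.symm x i • g i) (∑ i ∈ hfin.toFinset, Φ.symm x i • g i) :=
    hasSum_sum_of_ne_finset_zero fun i hi => by
      have : Φ.symm x i = 0 := by simpa using hi
      simp [this]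
  rw [h2.unique h3]
  exact Submodule.sum_mem _ fun i _ => Submodule.smul_mem _ _ (Submodule.subset_span ⟨i, rfl⟩)

/-- The oblique projection onto the span of finitely many vectors of a Riesz basis along the closed
span of the others. -/
lemma IsRieszBasis.exists_projection [CompleteSpace H] {f : ι → H} {I : Set ι}
    (h : IsRieszBasis 𝕜 (fun i : I => f i)) {F : Finset ι} (hF : (F : Set ι) ⊆ I) :
    ∃ p : H →L[𝕜] H, (∀ i ∈ F, p (f i) = f i) ∧ (∀ i ∈ I, i ∉ F → p (f i) = 0) ∧
      ∀ x, p x ∈ Submodule.span 𝕜 (f '' (F : Set ι)) := by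
  classical
  obtain ⟨Φ, hΦ⟩ := h.exists_equiv
  let p : H →L[𝕜] H := ∑ j ∈ F.subtype (· ∈ I),
    ((innerSL 𝕜 (lp.single 2 j (1 : 𝕜) : lp (fun _ : I => 𝕜) 2)) ∘L
      (Φ.symm : H →L[𝕜] lp (fun _ : I => 𝕜) 2)).smulRight (f j)
  have hp : ∀ x, p x = ∑ j ∈ F.subtype (· ∈ I), Φ.symm x j • f j := fun x => by
    simp [p, lp.inner_single_left]
  have hpI : ∀ i : I, p (f i) = if (i : ι) ∈ F then f i else 0 := fun i => by
    have h1 : Φ.symm (f i) = lp.single 2 i 1 := by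
      rw [ContinuousLinearEquiv.symm_apply_eq, hΦ, one_smul]
    rw [hp, h1]
    have h2 : ∀ j : I, (lp.single 2 i (1 : 𝕜) : lp (fun _ : I => 𝕜) 2) j • f j =
        if i = j then f i else 0 := fun j => by
      by_cases hij : i = j
      · subst hij
        simp
      · rw [lp.single_apply_ne _ _ _ (Ne.symm hij), zero_smul, if_neg hij]
    simp only [h2, Finset.sum_ite_eq, Finset.mem_subtype]
  refine ⟨p, fun i hi => ?_, fun i hi hiF => ?_, fun x => ?_⟩
  · simpa [hi] using hpI ⟨i, hF hi⟩
  · simpa [hiF] using hpI ⟨i, hi⟩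
  · rw [hp]
    exact Submodule.sum_mem _ fun j hj => Submodule.smul_mem _ _
      (Submodule.subset_span ⟨j, Finset.mem_subtype.1 hj, rfl⟩)

lemma apply_eq_self_of_mem_span {f : ι → H} {s : Set ι} {p : H →L[𝕜] H}
    (h : ∀ i ∈ s, p (f i) = f i) {y : H} (hy : y ∈ Submodule.span 𝕜 (f '' s)) : p y = y := by
  have : Submodule.span 𝕜 (f '' s) ≤ LinearMap.eqLocus p.toLinearMap (LinearMap.id : H →ₗ[𝕜] H) :=
    Submodule.span_le.2 (by rintro _ ⟨i, hi, rfl⟩; exact h i hi)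
  exact this hy

/-- Under linear independence the stable expansions are the only ones. -/
lemma HasStableExpansions.subset {C : ℝ} {f : ι → H} {J s : Set ι}
    (h : HasStableExpansions 𝕜 C f J) (hli : LinearIndepOn 𝕜 f J) (hs : s ⊆ J) :
    HasStableExpansions 𝕜 C f s := by
  intro x hx
  obtain ⟨a, ha, hax⟩ := (Finsupp.mem_span_image_iff_linearCombination 𝕜).1 hx
  obtain ⟨b, hb, hbx, hbn⟩ := h x (Submodule.span_mono (Set.image_mono hs) hx)
  have : a - b = 0 := linearIndepOn_iff.1 hli _
    (sub_mem (Finsupp.supported_mono hs ha) hb) (by rw [map_sub, hax, hbx, sub_self])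
  rw [sub_eq_zero] at this
  exact ⟨b, this ▸ ha, hbx, hbn⟩

lemma HasStableExpansions.isRieszBasis {C B : ℝ} (hC : 0 < C) (hB0 : 0 < B) {f : ι → H}
    (hB : IsBessel 𝕜 B f) {J : Set ι} (h : HasStableExpansions 𝕜 C f J)
    (hli : LinearIndepOn 𝕜 f J) (htop : (Submodule.span 𝕜 (f '' J)).topologicalClosure = ⊤) :
    IsRieszBasis 𝕜 (fun i : J => f i) := by
  classical
  refine ⟨by rw [closedSpan, ← Set.image_eq_range, htop], 1 / √C, √B, by positivity, by positivity,
    fun s a => ?_⟩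
  set x := ∑ i ∈ s, a i • f i with hx
  constructor
  · obtain ⟨b, hb, hbx, hbn⟩ := h x (Submodule.sum_mem _ fun i _ => Submodule.smul_mem _ _
      (Submodule.subset_span ⟨i, i.2, rfl⟩))
    set t := b.support.subtype (· ∈ J) with ht
    have hbt : ∑ i ∈ t, b i • f i = x := by
      rw [← hbx, Finsupp.linearCombination_apply, Finsupp.sum, ht]
      exact Finset.sum_subtype_of_mem (fun i => b i • f i)
        fun i hi => (Finsupp.mem_supported _ _).1 hb hi
    have hab : ∀ i ∈ s, a i = b i := fun i hi => by
      have h1 : ∑ i ∈ s ∪ t, ((if i ∈ s then a i else 0) - b i) • f i = 0 := by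
        simp only [sub_smul, Finset.sum_sub_distrib, ite_smul, zero_smul]
        rw [Finset.sum_ite_mem, Finset.inter_eq_right.2 Finset.subset_union_left,
          ← Finset.sum_subset (Finset.subset_union_right : t ⊆ s ∪ t) fun i _ hi => ?_, hbt, ← hx,
          sub_self]
        have : b i = 0 := by simpa [ht] using hi
        simp [this]
      have h2 := linearIndependent_iff'.1 hli (s ∪ t) _ h1 i (Finset.mem_union_left _ hi)
      simpa [hi, sub_eq_zero] using h2
    have h1 : ∑ i ∈ s, ‖a i‖ ^ 2 ≤ C * ‖x‖ ^ 2 := by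
      refine le_trans ?_ hbn
      have e : ∑ i ∈ s, ‖a i‖ ^ 2 =
          ∑ i ∈ s.map (Function.Embedding.subtype _), ‖b i‖ ^ 2 := by
        rw [Finset.sum_map]
        exact Finset.sum_congr rfl fun i hi => by
          rw [hab i hi]
          rfl
      rw [e]
      refine (Finset.sum_le_sum_of_subset_of_nonneg (Finset.subset_union_left (s₂ := b.support))
        fun _ _ _ => by positivity).trans_eq ?_
      exact (Finset.sum_subset Finset.subset_union_right fun i _ hi => by
        simp [Finsupp.notMem_support_iff.1 hi]).symm
    rw [one_div, ← div_eq_inv_mul, div_le_iff₀ (by positivity)]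
    calc √(∑ i ∈ s, ‖a i‖ ^ 2) ≤ √(C * ‖x‖ ^ 2) := Real.sqrt_le_sqrt h1
      _ = _ := by rw [Real.sqrt_mul hC.le, Real.sqrt_sq (norm_nonneg _), mul_comm]
  · have hBJ : IsBessel 𝕜 B (fun i : J => f i) := hB.comp Subtype.val_injective
    have h1 := hBJ.sq_norm_sum_le hB0.le s a
    rw [← Real.sqrt_mul hB0.le]
    exact Real.le_sqrt_of_sq_le h1

/-! ### From the subframe property to a natural splitting -/

lemma IsBessel.summable_sq_norm_apply [CompleteSpace H] {B : ℝ} {f : ι → H} (hB : IsBessel 𝕜 B f)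
    (p : H →L[𝕜] H) (G : Submodule 𝕜 H) [FiniteDimensional 𝕜 G] (hp : ∀ x, p x ∈ G) :
    Summable fun i => ‖p (f i)‖ ^ 2 := by
  set e := stdOrthonormalBasis 𝕜 G
  have h1 : ∀ i, ‖p (f i)‖ ^ 2 = ∑ k, ‖inner 𝕜 (p.adjoint (e k)) (f i)‖ ^ 2 := fun i => by
    have := e.sum_sq_norm_inner_right ⟨p (f i), hp _⟩
    simp only [Submodule.coe_inner] at this
    simp only [ContinuousLinearMap.adjoint_inner_left]
    exact this.symm
  simp only [h1]
  exact summable_sum fun k _ => (hB _).1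

lemma IsBessel.of_eq_or_apply [CompleteSpace H] {B : ℝ} (hB0 : 0 ≤ B) {f u : ι → H}
    (hB : IsBessel 𝕜 B f) (q : H →L[𝕜] H) (hu : ∀ i, u i = f i ∨ u i = q (f i) ∨ u i = 0) :
    IsBessel 𝕜 (B * (1 + ‖q‖ ^ 2)) u := by
  intro x
  have h1 : ∀ i, ‖inner 𝕜 x (u i)‖ ^ 2 ≤
      ‖inner 𝕜 x (f i)‖ ^ 2 + ‖inner 𝕜 (q.adjoint x) (f i)‖ ^ 2 := fun i => by
    have n1 : 0 ≤ ‖inner 𝕜 x (f i)‖ ^ 2 := by positivity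
    have n2 : 0 ≤ ‖inner 𝕜 (q.adjoint x) (f i)‖ ^ 2 := by positivity
    rcases hu i with h | h | h
    · rw [h]
      linarith
    · rw [h, ← ContinuousLinearMap.adjoint_inner_left]
      linarith
    · rw [h, inner_zero_right, norm_zero]
      linarith
  have h2 := (hB x).1.add (hB (q.adjoint x)).1
  have h3 := h2.of_nonneg_of_le (fun i => by positivity) h1
  refine ⟨h3, (h3.tsum_le_tsum h1 h2).trans ?_⟩
  rw [(hB x).1.tsum_add (hB (q.adjoint x)).1]
  have h4 : ‖q.adjoint x‖ ≤ ‖q‖ * ‖x‖ := by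
    refine (q.adjoint.le_opNorm x).trans ?_
    rw [LinearIsometryEquiv.norm_map]
  calc _ ≤ B * ‖x‖ ^ 2 + B * ‖q.adjoint x‖ ^ 2 := add_le_add (hB x).2 (hB _).2
    _ ≤ B * ‖x‖ ^ 2 + B * (‖q‖ * ‖x‖) ^ 2 := by gcongr
    _ = _ := by ring

lemma HasExpansion.congr {f u : ι → H} {s : Set ι} {R : ℝ} {x : H} (h : HasExpansion 𝕜 f s R x)
    (hu : ∀ i ∈ s, u i = f i) : HasExpansion 𝕜 u s R x := by
  obtain ⟨a, h1, h2, h3⟩ := h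
  refine ⟨a, h1, ?_, h3⟩
  rw [← h2, Finsupp.linearCombination_apply, Finsupp.linearCombination_apply]
  exact Finset.sum_congr rfl fun i hi => by
    simp only [hu i ((Finsupp.mem_supported _ _).1 h1 hi)]

/-- Let `p` be the projection onto the span of the `f i`, `i ∈ F`, along the other vectors of the
Riesz basis `(f i)`, `i ∈ I`. Stability of the expansions in the families indexed by `F ∪ t` is what
is needed to expand stably in any family of vectors `f i`, `i ∈ I`, and `f i - p (f i)`: the two
components `p x` and `x - p x` are treated separately, and applying `1 - p` to an expansion of
the second one deletes the terms with index in `F`. -/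
lemma exists_hasStableExpansions_of_projection {f u : ι → H} {I T : Set ι} {F : Finset ι} {C C' : ℝ}
    (hC : 0 < C) (hC' : 0 < C') (hFI : (F : Set ι) ⊆ I) (hIT : I ⊆ F ∪ T) {p : H →L[𝕜] H}
    (hpF : ∀ i ∈ F, p (f i) = f i) (hp0 : ∀ i ∈ I, i ∉ F → p (f i) = 0)
    (hpG : ∀ x, p x ∈ Submodule.span 𝕜 (f '' (F : Set ι)))
    (hI : ∀ s ⊆ I, HasStableExpansions 𝕜 C' f s)
    (hT : ∀ t ⊆ T, HasStableExpansions 𝕜 C f (F ∪ t))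
    (huI : ∀ i ∈ I, u i = f i) (huT : ∀ i ∉ I, i ∈ T → u i = f i - p (f i))
    (hu0 : ∀ i ∉ I, i ∉ T → u i = 0) :
    ∃ K > 0, ∀ s : Set ι, HasStableExpansions 𝕜 K u s := by
  classical
  have hpG' : ∀ y ∈ Submodule.span 𝕜 (f '' (F : Set ι)), p y = y := fun y hy =>
    apply_eq_self_of_mem_span hpF hy
  have hpp : ∀ x, p (p x) = p x := fun x => hpG' _ (hpG x)
  set q : H →L[𝕜] H := ContinuousLinearMap.id 𝕜 H - p with hq
  have hqx : ∀ x, q x = x - p x := fun x => rfl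
  have hqF : ∀ i ∈ F, q (f i) = 0 := fun i hi => by rw [hqx, hpF i hi, sub_self]
  have hqq : ∀ x, q (q x) = q x := fun x => by simp [hqx, hpp]
  refine ⟨2 * (C' * (‖p‖ + 1) ^ 2 + C * ‖q‖ ^ 2), by positivity, fun s x hx => ?_⟩
  set t : Set ι := {i | i ∈ s ∧ i ∈ T ∧ i ∉ F} with ht
  have hut : ∀ i ∈ t, u i = q (f i) := fun i hi => by
    by_cases h : i ∈ I
    · rw [huI i h, hqx, hp0 i h hi.2.2, sub_zero]
    · rw [huT i h hi.2.1, hqx]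
  have hcases : ∀ i ∈ s, (i ∈ F) ∨ i ∈ t ∨ u i = 0 := fun i hi => by
    by_cases h1 : i ∈ F
    · exact Or.inl h1
    · by_cases h2 : i ∈ T
      · exact Or.inr (Or.inl ⟨hi, h2, h1⟩)
      · exact Or.inr (Or.inr (hu0 i (fun hI => (hIT hI).elim h1 h2) h2))
  have hpx : p x ∈ Submodule.span 𝕜 (f '' (s ∩ F)) := by
    have : Submodule.span 𝕜 (u '' s) ≤ (Submodule.span 𝕜 (f '' (s ∩ F))).comap p.toLinearMap := by
      refine Submodule.span_le.2 ?_
      rintro _ ⟨i, hi, rfl⟩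
      change p (u i) ∈ Submodule.span 𝕜 (f '' (s ∩ F))
      rcases hcases i hi with h | h | h
      · rw [huI i (hFI h), hpF i h]
        exact Submodule.subset_span ⟨i, ⟨hi, h⟩, rfl⟩
      · rw [hut i h, hqx, map_sub, hpp, sub_self]
        exact zero_mem _
      · rw [h, map_zero]
        exact zero_mem _
    exact this hx
  have hqx' : q x ∈ Submodule.span 𝕜 (f '' (F ∪ t)) := by
    have : Submodule.span 𝕜 (u '' s) ≤ (Submodule.span 𝕜 (f '' (F ∪ t))).comap q.toLinearMap := by
      refine Submodule.span_le.2 ?_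
      rintro _ ⟨i, hi, rfl⟩
      change q (u i) ∈ Submodule.span 𝕜 (f '' (F ∪ t))
      rcases hcases i hi with h | h | h
      · rw [huI i (hFI h), hqF i h]
        exact zero_mem _
      · rw [hut i h, hqq, hqx]
        exact sub_mem (Submodule.subset_span ⟨i, Or.inr h, rfl⟩)
          (Submodule.span_mono (Set.image_mono Set.subset_union_left) (hpG _))
      · rw [h, map_zero]
        exact zero_mem _
    exact this hx
  have e1 : HasExpansion 𝕜 u (s ∩ F) (C' * ‖p x‖ ^ 2) (p x) :=
    (hI (s ∩ F) (Set.inter_subset_right.trans hFI) _ hpx).congr fun i hi => huI i (hFI hi.2)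
  have e2 : HasExpansion 𝕜 u t (C * ‖q x‖ ^ 2) (q x) := by
    obtain ⟨b, hb, hbx, hbn⟩ := hT t (fun i hi => hi.2.1) _ hqx'
    have hsup := (Finsupp.mem_supported _ _).1 hb
    have hsum : ∑ i ∈ b.support.filter (· ∉ F), b i • u i = q x := by
      rw [← hqq x]
      conv_rhs => rw [← hbx, Finsupp.linearCombination_apply, Finsupp.sum, map_sum]
      rw [Finset.sum_filter]
      refine Finset.sum_congr rfl fun i hi => ?_
      by_cases h : i ∈ F
      · simp [h, hqF i h]
      · rw [if_pos h, hut i ((hsup hi).resolve_left h), map_smul]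
    refine (HasExpansion.of_finset _ _ hsum).mono (fun i hi => ?_)
      ((Finset.sum_le_sum_of_subset_of_nonneg (Finset.filter_subset _ _)
        fun _ _ _ => by positivity).trans hbn)
    obtain ⟨h1, h2⟩ := Finset.mem_filter.1 hi
    exact (hsup h1).resolve_left h2
  have hxpq : p x + q x = x := by simp [hqx]
  have e3 := e1.add e2
  rw [hxpq] at e3
  refine e3.mono (Set.union_subset Set.inter_subset_left fun i hi => hi.1) ?_
  have n1 : ‖p x‖ ≤ (‖p‖ + 1) * ‖x‖ := (p.le_opNorm x).trans (by gcongr; linarith)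
  have n2 : ‖q x‖ ≤ ‖q‖ * ‖x‖ := q.le_opNorm x
  calc 2 * (C' * ‖p x‖ ^ 2 + C * ‖q x‖ ^ 2)
      ≤ 2 * (C' * ((‖p‖ + 1) * ‖x‖) ^ 2 + C * (‖q‖ * ‖x‖) ^ 2) := by gcongr
    _ = _ := by ring

lemma HasSubframeProperty.splitsNaturally [CompleteSpace H] {f : ℕ → H} (hf : IsFrame 𝕜 f)
    (h : HasSubframeProperty 𝕜 f) : SplitsNaturally 𝕜 f := by
  classical
  obtain ⟨B, hB0, hB⟩ := (isFrame_iff.1 hf).2.exists_isBessel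
  obtain ⟨F₀, N, I, C, hC, hF₀I, hI, hli, htop, hst⟩ := h.exists_linearIndepOn hf
  -- The full basis is one of the families with stable expansions.
  have hstI : HasStableExpansions 𝕜 C f I := by
    have : (F₀ : Set ℕ) ∪ (I ∩ Set.Ici N) = I := by
      ext i
      constructor
      · rintro (hi | hi)
        · exact hF₀I hi
        · exact hi.1
      · exact fun hi => (hI hi).imp id fun h => ⟨hi, h⟩
    rw [← this]
    exact hst _ Set.inter_subset_right
  have hRB : IsRieszBasis 𝕜 (fun i : I => f i) := hstI.isRieszBasis hC hB0 hB hli htop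
  -- `F` is chosen so large that every `f i`, `i < N`, of finite support lies in `G`.
  obtain ⟨F, hF₀F, hFI, hFN⟩ : ∃ F : Finset ℕ, F₀ ⊆ F ∧ (F : Set ℕ) ⊆ I ∧
      ∀ i < N, f i ∈ Submodule.span 𝕜 (f '' I) → f i ∈ Submodule.span 𝕜 (f '' (F : Set ℕ)) := by
    have h1 : ∀ i, ∃ S : Finset ℕ, (S : Set ℕ) ⊆ I ∧ (f i ∈ Submodule.span 𝕜 (f '' I) →
        f i ∈ Submodule.span 𝕜 (f '' (S : Set ℕ))) := fun i => by
      by_cases hi : f i ∈ Submodule.span 𝕜 (f '' I)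
      · obtain ⟨a, ha, hax⟩ := (Finsupp.mem_span_image_iff_linearCombination 𝕜).1 hi
        exact ⟨a.support, (Finsupp.mem_supported _ _).1 ha, fun _ =>
          (Finsupp.mem_span_image_iff_linearCombination 𝕜).2
            ⟨a, (Finsupp.mem_supported _ _).2 le_rfl, hax⟩⟩
      · exact ⟨∅, by simp, fun h => absurd h hi⟩
    choose S hSI hS using h1
    refine ⟨F₀ ∪ (Finset.range N).biUnion S, Finset.subset_union_left, ?_, fun i hi hfi => ?_⟩
    · intro i hi
      rcases Finset.mem_union.1 hi with hi | hi
      · exact hF₀I hi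
      · obtain ⟨j, -, hj⟩ := Finset.mem_biUnion.1 hi
        exact hSI j hj
    · refine Submodule.span_mono (Set.image_mono ?_) (hS i hfi)
      exact_mod_cast (Finset.subset_biUnion_of_mem S (Finset.mem_range.2 hi)).trans
        Finset.subset_union_right
  have hIF : I ⊆ F ∪ Set.Ici N := hI.trans (Set.union_subset_union_left _ (by exact_mod_cast hF₀F))
  have hstF : ∀ t ⊆ Set.Ici N, HasStableExpansions 𝕜 C f (F ∪ t) := fun t ht => by
    have : (F : Set ℕ) ∪ t = (F₀ : Set ℕ) ∪ (((F : Set ℕ) ∩ Set.Ici N) ∪ t) := by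
      ext i
      constructor
      · rintro (hi | hi)
        · exact (hI (hFI hi)).imp id fun h => Or.inl ⟨hi, h⟩
        · exact Or.inr (Or.inr hi)
      · rintro (hi | hi | hi)
        · exact Or.inl (hF₀F hi)
        · exact Or.inl hi.1
        · exact Or.inr hi
    rw [this]
    exact hst _ (Set.union_subset Set.inter_subset_right ht)
  obtain ⟨p, hpF, hp0, hpG⟩ := hRB.exists_projection hFI
  set Λ : Set ℕ := {i | i ∉ I ∧ i < N ∧ f i ∉ Submodule.span 𝕜 (f '' I)} with hΛ
  set Γ : Set ℕ := (I ∪ Λ)ᶜ with hΓ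
  have hΓI : ∀ i ∈ Γ, i ∉ I := fun i hi hi' => hi (Or.inl hi')
  set G := Submodule.span 𝕜 (f '' (F : Set ℕ)) with hG
  have : FiniteDimensional 𝕜 G := FiniteDimensional.span_of_finite 𝕜 (F.finite_toSet.image f)
  have hpG' : ∀ y ∈ G, p y = y := fun y hy => apply_eq_self_of_mem_span hpF hy
  refine ⟨I, Γ, Λ, F, fun i => f i - p (f i), fun i => p (f i), ?_, ?_⟩
  · refine ⟨?_, ?_, ?_, ?_, ?_, hFI, hRB, ?_, ?_, ?_, ?_, ?_⟩
    · rw [Set.union_right_comm, hΓ, Set.union_compl_self]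
    · exact Set.disjoint_left.2 fun i hi hi' => hΓI i hi' hi
    · exact Set.disjoint_left.2 fun i hi hi' => hi'.1 hi
    · exact Set.disjoint_left.2 fun i hi hi' => hi (Or.inr hi')
    · exact (Set.finite_lt_nat N).subset fun i hi => hi.2.1
    · intro i hi
      refine hRB.hasInfiniteSupport ?_
      rw [← Set.image_eq_range]
      exact hi.2.2
    · exact fun i _ => (sub_add_cancel _ _).symm
    · exact fun i _ => hpG _
    · exact (hB.summable_sq_norm_apply p G hpG).subtype Γ
    · set u : ℕ → H := fun i => if i ∈ I then f i else if i ∈ Γ then f i - p (f i) else 0 with hu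
      have huI : ∀ i ∈ I, u i = f i := fun i hi => by simp [hu, hi]
      have huΓ : ∀ i ∈ Γ, u i = f i - p (f i) := fun i hi => by simp [hu, hi, hΓI i hi]
      have huT : ∀ i ∉ I, i ∈ Set.Ici N → u i = f i - p (f i) := fun i hi hN =>
        huΓ i fun h => h.elim hi fun h => absurd h.2.1 (not_lt.2 hN)
      have hu0 : ∀ i ∉ I, i ∉ Set.Ici N → u i = 0 := fun i hi hN => by
        by_cases h : i ∈ Γ
        · have hiN : i < N := not_le.1 hN
          have : f i ∈ Submodule.span 𝕜 (f '' I) := by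
            by_contra hs
            exact h (Or.inr ⟨hi, hiN, hs⟩)
          rw [huΓ i h, hpG' _ (hFN i hiN this), sub_self]
        · simp [hu, hi, h]
      obtain ⟨K, hK, hKs⟩ := exists_hasStableExpansions_of_projection hC hC hFI hIF hpF hp0 hpG
        (fun s hs => hstI.subset hli hs) hstF huI huT hu0
      set q : H →L[𝕜] H := ContinuousLinearMap.id 𝕜 H - p with hq
      have huB : IsBessel 𝕜 (B * (1 + ‖q‖ ^ 2)) u := hB.of_eq_or_apply hB0.le q fun i => by
        by_cases hi : i ∈ I
        · exact Or.inl (huI i hi)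
        · by_cases hi' : i ∈ Γ
          · exact Or.inr (Or.inl (huΓ i hi'))
          · exact Or.inr (Or.inr (by simp [hu, hi, hi']))
      set e : I ⊕ Γ → ℕ := Sum.elim Subtype.val Subtype.val with he
      have hinj : Function.Injective e :=
        Subtype.val_injective.sumElim Subtype.val_injective fun i j hij => hΓI j j.2 (hij ▸ i.2)
      have hue : (Sum.elim (fun i : I => f i) (fun i : Γ => f i - p (f i))) = fun j => u (e j) := by
        funext j
        rcases j with i | i
        · exact (huI i i.2).symm
        · exact (huΓ i i.2).symm
      rw [hue, isRieszFrame_iff]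
      refine ⟨?_, 1 / K, B * (1 + ‖q‖ ^ 2), by positivity, by positivity, fun s => ?_⟩
      · rw [eq_top_iff, ← hRB.1]
        refine closedSpan_le (isClosed_closedSpan 𝕜 _) fun i => ?_
        rw [← huI i i.2]
        exact mem_closedSpan 𝕜 (fun j => u (e j)) (Sum.inl i)
      · let φ : s → (e '' s) := fun j => ⟨e j, j, j.2, rfl⟩
        have hφ : Function.Injective φ := fun j k hjk =>
          Subtype.ext (hinj (congrArg Subtype.val hjk))
        have h0 : ∀ i ∉ Set.range φ, u (i : (e '' s)) = 0 := by
          rintro ⟨_, j, hj, rfl⟩ hi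
          exact absurd ⟨⟨j, hj⟩, rfl⟩ hi
        rw [show (fun i : s => u (e i)) = fun i => (fun i : (e '' s) => u i) (φ i) from rfl,
          hasFrameBounds_comp (w := fun i : (e '' s) => u i) hφ h0,
          closedSpan_comp (w := fun i : (e '' s) => u i) h0]
        exact (hKs (e '' s)).hasFrameBounds hK huB
  · -- The range of `1 - p` is the complement of `G` given by the Riesz basis.
    intro i _
    set W := closedSpan 𝕜 (fun j : (I \ (F : Set ℕ) : Set ℕ) => f j) with hW
    set q : H →L[𝕜] H := ContinuousLinearMap.id 𝕜 H - p with hq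
    have : closedSpan 𝕜 (fun i : I => f i) ≤ W.comap q.toLinearMap := by
      refine closedSpan_le ((isClosed_closedSpan 𝕜 _).preimage q.continuous) fun j => ?_
      change f j - p (f j) ∈ W
      by_cases hj : (j : ℕ) ∈ F
      · rw [hpF j hj, sub_self]
        exact zero_mem _
      · rw [hp0 j j.2 hj, sub_zero]
        exact mem_closedSpan 𝕜 (fun j : (I \ (F : Set ℕ) : Set ℕ) => f j) ⟨j, j.2, hj⟩
    rw [hRB.1] at this
    exact this (Submodule.mem_top : f i ∈ ⊤)

/-! ### From a natural to an orthogonal splitting -/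

/-- With `p` the projection onto `G` along the natural complement `W` and `P` the orthogonal
projection onto `G`, the isomorphism `x ↦ p x + (x - P x)` is the identity on `G` and maps `W` to
`Gᗮ`. -/
lemma SplitsNaturally.exists_splitsOrthogonally [CompleteSpace H] {f : ι → H}
    (h : SplitsNaturally 𝕜 f) : ∃ T : H ≃L[𝕜] H, SplitsOrthogonally 𝕜 (fun i => T (f i)) := by
  obtain ⟨I, Γ, Λ, F, h₁, h₂, hs, hW⟩ := h
  obtain ⟨p, hpF, hp0, hpG⟩ := hs.rieszBasis.exists_projection hs.F_subset
  set G := Submodule.span 𝕜 (f '' (F : Set ι)) with hG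
  have : FiniteDimensional 𝕜 G := FiniteDimensional.span_of_finite 𝕜 (F.finite_toSet.image f)
  have hpG' : ∀ y ∈ G, p y = y := fun y hy => apply_eq_self_of_mem_span hpF hy
  set P := G.starProjection with hP
  have hPG : ∀ x, P x ∈ G := G.starProjection_apply_mem
  have hPG' : ∀ y ∈ G, P y = y := fun y hy => Submodule.starProjection_eq_self_iff.2 hy
  have hpp : ∀ x, p (p x) = p x := fun x => hpG' _ (hpG x)
  have hPp : ∀ x, P (p x) = p x := fun x => hPG' _ (hpG x)
  have hpP : ∀ x, p (P x) = P x := fun x => hpG' _ (hPG x)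
  have hPP : ∀ x, P (P x) = P x := fun x => hPG' _ (hPG x)
  let T₁ : H →L[𝕜] H := p + (ContinuousLinearMap.id 𝕜 H - P)
  let T₂ : H →L[𝕜] H := P + (ContinuousLinearMap.id 𝕜 H - p) ∘L (ContinuousLinearMap.id 𝕜 H - P)
  have hT₁ : ∀ x, T₁ x = p x + (x - P x) := fun x => rfl
  have hT₂ : ∀ x, T₂ x = P x + ((x - P x) - p (x - P x)) := fun x => rfl
  let T : H ≃L[𝕜] H := ContinuousLinearEquiv.equivOfInverse T₁ T₂
    (fun x => by
      simp only [hT₁, hT₂, map_add, map_sub, hpp, hPp, hpP, hPP]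
      abel)
    (fun x => by
      simp only [hT₁, hT₂, map_add, map_sub, hpp, hPp, hpP, hPP]
      abel)
  have hT : ∀ x, T x = p x + (x - P x) := fun x => rfl
  refine ⟨T, I, Γ, Λ, F, _, _, hs.map T, fun i hi => ?_⟩
  have himage : (fun i => T (f i)) '' (F : Set ι) = f '' (F : Set ι) :=
    Set.image_congr fun j hj => by
      have hjG : f j ∈ G := Submodule.subset_span ⟨j, hj, rfl⟩
      rw [hT, hpG' _ hjG, hPG' _ hjG, sub_self, add_zero]
  rw [himage, ← hG]
  have hker : p (h₁ i) = 0 := by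
    have : closedSpan 𝕜 (fun j : (I \ (F : Set ι) : Set ι) => f j) ≤ p.ker :=
      closedSpan_le p.isClosed_ker fun j => hp0 j j.2.1 j.2.2
    exact this (hW i hi)
  rw [hT, hker, zero_add]
  exact Submodule.sub_starProjection_mem_orthogonal _

end FrameTheory

theorem theorem3p2 {𝕜 : Type*} [RCLike 𝕜] {H : Type*} [NormedAddCommGroup H]
    [InnerProductSpace 𝕜 H] [CompleteSpace H] (f : ℕ → H) (hf : FrameTheory.IsFrame 𝕜 f) :
    (FrameTheory.HasSubframeProperty 𝕜 f ↔ FrameTheory.SplitsNaturally 𝕜 f) ∧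
    (FrameTheory.HasSubframeProperty 𝕜 f ↔
      ∃ T : H ≃L[𝕜] H, FrameTheory.SplitsOrthogonally 𝕜 (fun i => T (f i))) := by
  refine ⟨⟨fun h => h.splitsNaturally hf, ?_⟩,
    ⟨fun h => (h.splitsNaturally hf).exists_splitsOrthogonally, ?_⟩⟩
  · rintro ⟨I, Γ, Λ, F, h₁, h₂, hs, -⟩
    exact hs.hasSubframeProperty
  · rintro ⟨T, I, Γ, Λ, F, h₁, h₂, hs, -⟩
    simpa using hs.hasSubframeProperty.map T.symm
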